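/- Let $\mathfrak A$ be a complex Banach algebra, not necessarily unital. A (bounded) multiplier of $\mathfrak A$ is a pair $m$ of bounded linear maps $a\mapsto ma$, $a\mapsto am$ on $\mathfrak A$ with $m(ab)=(ma)b$, $(ab)m=a(bm)$ and $(am)b=a(mb)$ for all $a,b\in\mathfrak A$; multipliers form a unital Banach algebra under composition, with norm the maximum of the two operator norms. Let $S,R$ be multipliers of $\mathfrak A$ with $RS=1$ and $SR\ne1$. Put $\mathfrak A_k=\{a\in\mathfrak A: R^ka=0=aS^k\}$ and $\mathfrak A_\infty=\bigcup_k\mathfrak A_k$, and let $E_{ij}=S^{i-1}(1-SR)R^{j-1}$, $i,j\ge1$. A scalar matrix $U=(u_{ij})_{i,j\ge 1}$ that differs from the identity matrix in only finitely many entries is regarded as the multiplier $1+\sum_{i,j}(u_{ij}-\delta_{ij})E_{ij}$, which operates on $\mathfrak A_\infty$ by matrix multiplication. Let $\mathcal U$ be the group of matrices $D\Pi_{\mathfrak p}$, where $D$ is an infinite diagonal matrix with finitely many diagonal entries $-1$ and the others $+1$, and $\Pi_{\mathfrak p}$ is the matrix of a permutation $\mathfrak p$ of $\mathbb N$ that moves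 only finitely many points. Assume that 1. $\mathfrak A_\infty$ is dense in $\mathfrak A$; 2. there is $C>0$ such that $\|Ua\|\le C\|a\|$ and $\|aU\|\le C\|a\|$ for all $U\in\mathcal U$ and $a\in\mathfrak A_\infty$; 3. $\mathfrak A$ is strongly H-unital: for every Banach space $X$ the complex $$0\leftarrow X\widehat\otimes\mathfrak A\leftarrow X\widehat\otimes\mathfrak A^{\widehat\otimes2}\leftarrow X\widehat\otimes\mathfrak A^{\widehat\otimes3}\leftarrow\cdots$$ with differentials $\mathrm{id}_X\otimes\beta$, where $\beta(a_0\otimes\cdots\otimes a_n)=\sum_{i=0}^{n-1}(-1)^i\,a_0\otimes\cdots\otimes a_ia_{i+1}\otimes\cdots\otimes a_n$, is acyclic ($\widehat\otimes$ is the projective tensor product). Let $\mathfrak C$ be the closed subalgebra of the Banach algebra of multipliers generated by $\mathcal U$, and let $\mathfrak A\oplus\mathfrak C$ be the semidirect product, with norm $\|a\|+\|c\|$ and product $(a,c)(b,d)=(ab+cb+ad,\,cd)$. For $n\ge0$, a bounded $n$-cocycle on a Banach algebra $\mathfrak B$ is a bounded $(n+1)$-linear functional $D$ on $\mathfrak B$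 with $$\sum_{i=0}^{n}(-1)^iD(b_0,\dots,b_ib_{i+1},\dots,b_{n+1})+(-1)^{n+1}D(b_{n+1}b_0,b_1,\dots,b_n)=0\qquad(b_0,\dots,b_{n+1}\in\mathfrak B).$$ Then for every $n\ge0$ and every bounded $n$-cocycle $D$ on $\mathfrak A$ there is a bounded $n$-cocycle $\widetilde D$ on $\mathfrak A\oplus\mathfrak C$ with $\widetilde D((a_0,0),\dots,(a_n,0))=D(a_0,\dots,a_n)$ for all $a_0,\dots,a_n\in\mathfrak A$. -/

import Mathlib

open scoped TensorProduct MultiplierAlgebra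

universe u

noncomputable section

namespace MatrixBanach

/-! ### Projective tensor products and the bar complex -/

/-- The two-member family `false ↦ X`, `true ↦ Y`, used to form the binary tensor product. -/
def PairFam (X Y : Type u) : Bool → Type u
  | false => X
  | true => Y

instance PairFam.instNormedAddCommGroup (X Y : Type u) [NormedAddCommGroup X]
    [NormedAddCommGroup Y] : ∀ b, NormedAddCommGroup (PairFam X Y b)
  | false => inferInstanceAs (NormedAddCommGroup X)
  | true => inferInstanceAs (NormedAddCommGroup Y)

instance PairFam.instNormedSpace (X Y : Type u) [NormedAddCommGroup X] [NormedSpace ℂ X]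
    [NormedAddCommGroup Y] [NormedSpace ℂ Y] : ∀ b, NormedSpace ℂ (PairFam X Y b)
  | false => inferInstanceAs (NormedSpace ℂ X)
  | true => inferInstanceAs (NormedSpace ℂ Y)

/-- The projective tensor product `X ⊗̂ Y`: the completion of the algebraic tensor product for
the projective seminorm (which is Mathlib's norm on `PiTensorProduct`). -/
abbrev ProjTensor (X Y : Type u) [NormedAddCommGroup X] [NormedSpace ℂ X]
    [NormedAddCommGroup Y] [NormedSpace ℂ Y] : Type u :=
  UniformSpace.Completion (⨂[ℂ] b : Bool, PairFam X Y b)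

/-- The operator `id ⊗̂ f : X ⊗̂ Y → X ⊗̂ Z`. -/
def ProjTensor.idMap (X : Type u) {Y Z : Type u} [NormedAddCommGroup X] [NormedSpace ℂ X]
    [NormedAddCommGroup Y] [NormedSpace ℂ Y] [NormedAddCommGroup Z] [NormedSpace ℂ Z]
    (f : Y →L[ℂ] Z) : ProjTensor X Y →L[ℂ] ProjTensor X Z :=
  (PiTensorProduct.mapL (𝕜 := ℂ) (E := PairFam X Y) (E' := PairFam X Z)
    (fun b => match b with
      | false => ContinuousLinearMap.id ℂ X
      | true => f)).completion

section BarComplex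

variable (A : Type u) [NonUnitalNormedRing A] [NormedSpace ℂ A] [SMulCommClass ℂ A A]
  [IsScalarTower ℂ A A]

/-- The bounded `n`-chains of `A`: the `(n+1)`-fold projective tensor power of `A`. -/
abbrev Chains (n : ℕ) : Type u :=
  UniformSpace.Completion (⨂[ℂ] _ : Fin (n + 1), A)

variable {A}

/-- The tuple `(a₀, …, aᵢ aᵢ₊₁, …, aₙ₊₁)`. -/
def faceTuple {E : Type*} [Mul E] {n : ℕ} (i : Fin (n + 1)) (a : Fin (n + 2) → E) :
    Fin (n + 1) → E :=
  Fin.contractNth i.castSucc (· * ·) a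

theorem faceTuple_update {n : ℕ} (i : Fin (n + 1)) (a : Fin (n + 2) → A) (j : Fin (n + 2)) :
    ∃ (k : Fin (n + 1)) (f : A →ₗ[ℂ] A), ∀ x,
      faceTuple i (Function.update a j x) = Function.update (faceTuple i a) k (f x) := by
  have key : ∀ (k : Fin (n + 1)) (f : A →ₗ[ℂ] A),
      (∀ x l, faceTuple i (Function.update a j x) l
        = Function.update (faceTuple i a) k (f x) l) → ∃ (k : Fin (n + 1)) (f : A →ₗ[ℂ] A), ∀ x,
      faceTuple i (Function.update a j x) = Function.update (faceTuple i a) k (f x) :=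
    fun k f h => ⟨k, f, fun x => funext (h x)⟩
  have hi := i.2
  have hj := j.2
  rcases lt_or_ge (j : ℕ) i with h | h
  · refine key ⟨j, by omega⟩ LinearMap.id fun x l => ?_
    simp only [faceTuple, Fin.contractNth, Function.update_apply, Fin.ext_iff, Fin.val_castSucc,
      Fin.val_succ, LinearMap.id_apply]
    split_ifs <;> first | rfl | omega
  rcases Nat.eq_or_lt_of_le h with h | h
  · refine key i (LinearMap.mulRight ℂ (a i.succ)) fun x l => ?_
    simp only [faceTuple, Fin.contractNth, Function.update_apply, Fin.ext_iff, Fin.val_castSucc,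
      Fin.val_succ, LinearMap.mulRight_apply]
    split_ifs <;> first | rfl | omega | skip
    all_goals (congr 2; ext; simp; omega)
  rcases Nat.eq_or_lt_of_le h with h | h
  · refine key i (LinearMap.mulLeft ℂ (a i.castSucc)) fun x l => ?_
    simp only [faceTuple, Fin.contractNth, Function.update_apply, Fin.ext_iff, Fin.val_castSucc,
      Fin.val_succ, LinearMap.mulLeft_apply]
    split_ifs <;> first | rfl | omega | skip
    all_goals (congr 2; ext; simp; omega)
  · refine key ⟨j - 1, by omega⟩ LinearMap.id fun x l => ?_
    simp only [faceTuple, Fin.contractNth, Function.update_apply, Fin.ext_iff, Fin.val_castSucc,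
      Fin.val_succ, LinearMap.id_apply]
    split_ifs <;> first | rfl | omega

/-- `(a₀, …, aₙ₊₁) ↦ a₀ ⊗ ⋯ ⊗ aᵢ aᵢ₊₁ ⊗ ⋯ ⊗ aₙ₊₁`. -/
def faceMultilinear {n : ℕ} (i : Fin (n + 1)) :
    ContinuousMultilinearMap ℂ (fun _ : Fin (n + 2) => A) (⨂[ℂ] _ : Fin (n + 1), A) where
  toFun a := PiTensorProduct.tprod ℂ (faceTuple i a)
  map_update_add' {inst} a j x y := by
    obtain rfl : inst = instDecidableEqFin (n + 2) := Subsingleton.elim _ _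
    obtain ⟨k, f, h⟩ := faceTuple_update i a j
    simp only [h, map_add, MultilinearMap.map_update_add]
  map_update_smul' {inst} a j c x := by
    obtain rfl : inst = instDecidableEqFin (n + 2) := Subsingleton.elim _ _
    obtain ⟨k, f, h⟩ := faceTuple_update i a j
    simp only [h, map_smul, MultilinearMap.map_update_smul]
  cont := by
    refine (PiTensorProduct.tprodL ℂ (E := fun _ : Fin (n + 1) => A)).cont.comp ?_
    refine continuous_pi fun l => ?_
    unfold faceTuple Fin.contractNth
    split_ifs <;> fun_prop

/-- The face map `dᵢ`, `0 ≤ i ≤ n`, from `(n+1)`-chains to `n`-chains. -/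
def face {n : ℕ} (i : Fin (n + 1)) : Chains A (n + 1) →L[ℂ] Chains A n :=
  (PiTensorProduct.liftEquiv ℂ (fun _ : Fin (n + 2) => A) (⨂[ℂ] _ : Fin (n + 1), A)
    (faceMultilinear i)).completion

variable (A) in
/-- The bar differential `β = ∑_{i ≤ n} (-1)^i dᵢ` from `(n+1)`-chains to `n`-chains. -/
def barDiff (n : ℕ) : Chains A (n + 1) →L[ℂ] Chains A n :=
  ∑ i : Fin (n + 1), (-1 : ℂ) ^ (i : ℕ) • face i

variable (A) in
/-- `A` is strongly H-unital: for every Banach space `X` the complex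
`0 ← X ⊗̂ A ← X ⊗̂ A ⊗̂ A ← ⋯` with differentials `id ⊗̂ β` is acyclic. -/
def StronglyHUnital : Prop :=
  ∀ (X : Type u) [NormedAddCommGroup X] [NormedSpace ℂ X] [CompleteSpace X],
    Function.Surjective (ProjTensor.idMap X (barDiff A 0)) ∧
    ∀ n, Function.Exact (ProjTensor.idMap X (barDiff A (n + 1)))
      (ProjTensor.idMap X (barDiff A n))

end BarComplex

/-! ### Bounded Hochschild cocycles -/

/-- A bounded `n`-cochain, i.e. a bounded `(n+1)`-linear functional `D`, is an `n`-cocycle if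
`D ∘ δ = 0`, where `δ = ∑_{i ≤ n+1} (-1)^i dᵢ` on `(n+1)`-chains and the last face is
`(a₀, …, aₙ₊₁) ↦ (aₙ₊₁ a₀, a₁, …, aₙ)`. -/
def IsCocycle {E : Type*} [AddCommGroup E] [Module ℂ E] [TopologicalSpace E] [Mul E] {n : ℕ}
    (D : ContinuousMultilinearMap ℂ (fun _ : Fin (n + 1) => E) ℂ) : Prop :=
  ∀ a : Fin (n + 2) → E,
    ∑ i : Fin (n + 1), (-1 : ℂ) ^ (i : ℕ) * D (faceTuple i a)
      + (-1) ^ (n + 1) * D (Function.update (Fin.init a) 0 (a (Fin.last (n + 1)) * a 0)) = 0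

/-! ### Multipliers and the matrix structure -/

variable {A : Type u} [NonUnitalNormedRing A] [NormedSpace ℂ A] [SMulCommClass ℂ A A]
  [IsScalarTower ℂ A A]

/-- For `m : 𝓜(ℂ, A)` write `m a = m.fst a` and `a m = m.snd a`. Mathlib's double centralizers
satisfy `(x m) y = x (m y)`; a multiplier also satisfies `m (x y) = (m x) y` and
`(x y) m = x (y m)`. -/
def IsMultiplier (m : 𝓜(ℂ, A)) : Prop :=
  (∀ x y : A, m.fst (x * y) = m.fst x * y) ∧ (∀ x y : A, m.snd (x * y) = x * m.snd y)

/-- The corners: `⋃ₖ Aₖ` with `Aₖ = {a | Rᵏ a = a Sᵏ = 0}`. -/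
def corners (S R : 𝓜(ℂ, A)) : Set A :=
  {a | ∃ k : ℕ, (R ^ k).fst a = 0 ∧ (S ^ k).snd a = 0}

/-- The matrix unit `E_{ij} = Sⁱ (1 - S R) Rʲ` (indices starting from `0`). It carries the
`j`-th row of a matrix to the `i`-th row when multiplied from the left, and `E_{ii}` is the
projection `Sⁱ Rⁱ - Sⁱ⁺¹ Rⁱ⁺¹`. -/
def matrixUnit (S R : 𝓜(ℂ, A)) (i j : ℕ) : 𝓜(ℂ, A) :=
  S ^ i * (1 - S * R) * R ^ j

/-- The group of matrices `D Π_p`, with `D` diagonal with finitely many entries `-1` and all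
others `1`, and `Π_p` the matrix of a finite permutation `p`. -/
def signedPerms : Set (Matrix ℕ ℕ ℂ) :=
  {U | ∃ (ε : ℕ → ℂ) (p : Equiv.Perm ℕ), (∀ i, ε i = 1 ∨ ε i = -1) ∧ {i | ε i ≠ 1}.Finite ∧
    {i | p i ≠ i}.Finite ∧ U = Matrix.of fun i j => if i = p j then ε i else 0}

/-- The multiplier of `A` given by a scalar matrix `U` that differs from the identity matrix in
finitely many entries, i.e. `1 + ∑ᵢⱼ (Uᵢⱼ - δᵢⱼ) Eᵢⱼ`. -/
def matrixMultiplier (S R : 𝓜(ℂ, A)) (U : Matrix ℕ ℕ ℂ) : 𝓜(ℂ, A) :=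
  1 + ∑ᶠ ij : ℕ × ℕ, (U ij.1 ij.2 - (1 : Matrix ℕ ℕ ℂ) ij.1 ij.2) • matrixUnit S R ij.1 ij.2

/-- The group of signed finite permutation matrices operates boundedly on the corners, from the
left and from the right. -/
def SignedPermsActBoundedly (S R : 𝓜(ℂ, A)) : Prop :=
  ∃ C : ℝ, 0 < C ∧ ∀ U ∈ signedPerms, ∀ a ∈ corners S R,
    ‖(matrixMultiplier S R U).snd a‖ ≤ C * ‖a‖ ∧ ‖(matrixMultiplier S R U).fst a‖ ≤ C * ‖a‖

/-- The Banach algebra generated, inside the Banach algebra of multipliers, by the signed finite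
permutation matrices. -/
def signedPermAlgebra (S R : 𝓜(ℂ, A)) : Subalgebra ℂ 𝓜(ℂ, A) :=
  (Algebra.adjoin ℂ (matrixMultiplier S R '' signedPerms)).topologicalClosure

/-! ### The semidirect product -/

/-- The Banach space `A ⊕ C` with norm `‖a‖ + ‖c‖`. -/
abbrev SemidirectSum (A : Type u) [NonUnitalNormedRing A] [NormedSpace ℂ A]
    [SMulCommClass ℂ A A] [IsScalarTower ℂ A A] (C : Subalgebra ℂ 𝓜(ℂ, A)) : Type u :=
  WithLp 1 (A × C)

/-- `(a, c) (b, d) = (a b + c b + a d, c d)`. -/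
instance SemidirectSum.instMul (C : Subalgebra ℂ 𝓜(ℂ, A)) : Mul (SemidirectSum A C) where
  mul x y := WithLp.toLp 1
    (x.fst * y.fst + (x.snd : 𝓜(ℂ, A)).fst y.fst + (y.snd : 𝓜(ℂ, A)).snd x.fst, x.snd * y.snd)

/-- The inclusion `a ↦ (a, 0)`. -/
def SemidirectSum.inl (C : Subalgebra ℂ 𝓜(ℂ, A)) (a : A) : SemidirectSum A C :=
  WithLp.toLp 1 (a, 0)

end MatrixBanach

end

open MatrixBanach

open MatrixBanach

noncomputable section

namespace MatrixBanach

set_option linter.unusedSectionVars false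

/-!
The cocycle is extended by excision: a bounded cocycle on a strongly H-unital algebra `A` extends
to every Banach algebra that contains `A` as an ideal complemented by a closed subalgebra. This
applies to `A ⊕ C` for any closed algebra `C` of multipliers; of the matrix structure only the
fact that `S` and `R` are multipliers is used.
-/

/-! The proof is an excision argument. Put B = A ⊕ C with the inclusion ι of A and the projection π
onto A; then ι(A) is an ideal and ker π is a subalgebra. The crude extension f = D ∘ (π, …, π) is in
general not a cocycle. Its Hochschild coboundary δf is a cocycle that vanishes on words with all
letters in A, because D is a cocycle, and on words with all letters in ker π, because ker π is
multiplicatively closed. It suffices to write δf = δh with h bounded and zero on words in A: then f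
- h is a cocycle extending D.

The analytic input is a bounded linear choice of primitives in the dual bar complex of A
(`exists_bar_section`). Strong H-unitality is applied with X the Banach space of bar cocycles
itself. The tautological pairing of X with chains kills boundaries, exactness makes the range of id
⊗ β closed, and the open mapping theorem with Hahn–Banach factors the pairing through id ⊗ β.
Currying the factor gives the choice. In the bottom degree, a functional that kills products is
zero.

The combinatorial input is a filtration of words. A word has type (r, q) if it consists of r letters
in ker π, a nonempty block of letters of A, and q arbitrary letters; types are ordered
lexicographically. If a cochain vanishes on all lower types, every face except those inside the
block gives zero, so on type (r, q) the coboundary is (-1)^r times the dual bar differential in the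
block (`hoch_eq_bar_insertFun`). A cocycle therefore restricts to a family of bar cocycles indexed
by the outer letters. Primitives chosen linearly assemble to a cochain (`exists_block_primitive`)
whose coboundary removes this type without reviving lower ones (`exists_vanishesBelow_succ`). Once
all types are removed, splitting letters from the left into their A-part and ker π-part leaves
nothing (`eq_zero_of_vanishesBelow`).

For A ⊕ C to be associative, left and right actions of multipliers must commute on A. They do on
products, hence everywhere by the bottom degree of H-unitality (`snd_fst_apply`). -/

/-! ### Functionals on projective tensor products -/

/-- Continuous linear maps on a completed tensor product agree if they agree on pure tensors. -/
theorem completion_tprod_ext {ι : Type*} [Fintype ι] {E : ι → Type*}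
    [∀ i, NormedAddCommGroup (E i)] [∀ i, NormedSpace ℂ (E i)] {F : Type*}
    [NormedAddCommGroup F] [NormedSpace ℂ F]
    {f g : UniformSpace.Completion (⨂[ℂ] i, E i) →L[ℂ] F}
    (h : ∀ v : ∀ i, E i, f (PiTensorProduct.tprod ℂ v : ⨂[ℂ] i, E i) =
      g (PiTensorProduct.tprod ℂ v : ⨂[ℂ] i, E i)) : f = g := by
  ext x
  induction x using UniformSpace.Completion.induction_on with
  | hp => exact isClosed_eq f.continuous g.continuous
  | ih x =>
    induction x using PiTensorProduct.induction_on with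
    | smul_tprod r v =>
      rw [UniformSpace.Completion.coe_smul, map_smul, map_smul, h]
    | add x y hx hy =>
      rw [UniformSpace.Completion.coe_add, map_add, map_add, hx, hy]

/-- The extension of a continuous multilinear map to the completed tensor product. -/
def liftCompletion {ι : Type*} [Fintype ι] {E : ι → Type*}
    [∀ i, NormedAddCommGroup (E i)] [∀ i, NormedSpace ℂ (E i)] {F : Type*}
    [NormedAddCommGroup F] [NormedSpace ℂ F] [CompleteSpace F]
    (f : ContinuousMultilinearMap ℂ E F) : UniformSpace.Completion (⨂[ℂ] i, E i) →L[ℂ] F :=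
  (PiTensorProduct.liftEquiv ℂ E F f).extend UniformSpace.Completion.toComplL

theorem liftCompletion_tprod {ι : Type*} [Fintype ι] {E : ι → Type*}
    [∀ i, NormedAddCommGroup (E i)] [∀ i, NormedSpace ℂ (E i)] {F : Type*}
    [NormedAddCommGroup F] [NormedSpace ℂ F] [CompleteSpace F]
    (f : ContinuousMultilinearMap ℂ E F) (v : ∀ i, E i) :
    liftCompletion f (PiTensorProduct.tprod ℂ v : ⨂[ℂ] i, E i) = f v := by
  have := (PiTensorProduct.liftEquiv ℂ E F f).extend_eq
    (e := UniformSpace.Completion.toComplL (𝕜 := ℂ) (E := ⨂[ℂ] i, E i))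
    UniformSpace.Completion.denseRange_coe
    (UniformSpace.Completion.isUniformInducing_coe _) (PiTensorProduct.tprod ℂ v)
  refine this.trans ?_
  simp [PiTensorProduct.liftEquiv]

/-! ### Tensor products of two factors and bilinear forms -/

section Pairing

variable {E : Bool → Type*} [∀ b, NormedAddCommGroup (E b)] [∀ b, NormedSpace ℂ (E b)]

/-- The pair `(x, y)` as an element of a two-member family. -/
def pairTuple {E : Bool → Type*} (x : E false) (y : E true) : ∀ b, E b
  | false => x
  | true => y

theorem pairTuple_eta {E : Bool → Type*} (v : ∀ b, E b) : pairTuple (v false) (v true) = v := by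
  funext b; cases b <;> rfl

theorem update_false {E : Bool → Type*} (v : ∀ b, E b) (x : E false) :
    Function.update v false x = pairTuple x (v true) := by
  funext b; cases b <;> simp [pairTuple]

theorem update_true {E : Bool → Type*} (v : ∀ b, E b) (y : E true) :
    Function.update v true y = pairTuple (v false) y := by
  funext b; cases b <;> simp [pairTuple]

/-- A bounded bilinear form as a continuous multilinear map on a two-member family. -/
def pairMultilinear (Λ : E true →L[ℂ] E false →L[ℂ] ℂ) : ContinuousMultilinearMap ℂ E ℂ :=
  MultilinearMap.mkContinuous
    { toFun := fun v => Λ (v true) (v false)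
      map_update_add' := fun {inst} v b x y => by
        obtain rfl : inst = instDecidableEqBool := Subsingleton.elim _ _
        cases b <;> simp
      map_update_smul' := fun {inst} v b c x => by
        obtain rfl : inst = instDecidableEqBool := Subsingleton.elim _ _
        cases b <;> simp }
    ‖Λ‖ fun v => by
      rw [Fintype.prod_bool, ← mul_assoc]
      exact Λ.le_opNorm₂ _ _

/-- The pure tensor `x ⊗ y` in the completed tensor product of a two-member family. -/
def pairTensor (x : E false) (y : E true) : UniformSpace.Completion (⨂[ℂ] b, E b) :=
  ((PiTensorProduct.tprod ℂ (pairTuple x y) : ⨂[ℂ] b, E b) : UniformSpace.Completion _)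

theorem pairTensor_add_right (x : E false) (y y' : E true) :
    pairTensor x (y + y') = pairTensor x y + pairTensor x y' := by
  have := (PiTensorProduct.tprod ℂ (s := E)).map_update_add (pairTuple x y) true y y'
  simp only [update_true] at this
  exact (congrArg UniformSpace.Completion.coe' this).trans (UniformSpace.Completion.coe_add _ _)

theorem pairTensor_smul_right (c : ℂ) (x : E false) (y : E true) :
    pairTensor x (c • y) = c • pairTensor x y := by
  have := (PiTensorProduct.tprod ℂ (s := E)).map_update_smul (pairTuple x y) true c y
  simp only [update_true] at this
  exact (congrArg UniformSpace.Completion.coe' this).trans (UniformSpace.Completion.coe_smul _ _)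

theorem pairTensor_add_left (x x' : E false) (y : E true) :
    pairTensor (x + x') y = pairTensor x y + pairTensor x' y := by
  have := (PiTensorProduct.tprod ℂ (s := E)).map_update_add (pairTuple x y) false x x'
  simp only [update_false] at this
  exact (congrArg UniformSpace.Completion.coe' this).trans (UniformSpace.Completion.coe_add _ _)

theorem pairTensor_smul_left (c : ℂ) (x : E false) (y : E true) :
    pairTensor (c • x) y = c • pairTensor x y := by
  have := (PiTensorProduct.tprod ℂ (s := E)).map_update_smul (pairTuple x y) false c x
  simp only [update_false] at this
  exact (congrArg UniformSpace.Completion.coe' this).trans (UniformSpace.Completion.coe_smul _ _)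

theorem norm_pairTensor_le (x : E false) (y : E true) : ‖pairTensor x y‖ ≤ ‖x‖ * ‖y‖ := by
  rw [pairTensor, UniformSpace.Completion.norm_coe]
  refine (PiTensorProduct.projectiveSeminorm_tprod_le _).trans ?_
  rw [Fintype.prod_bool, mul_comm]
  exact le_rfl

/-- A functional on the completed tensor product of a two-member family as a bilinear form. -/
def curryPairTensor (Ψ : UniformSpace.Completion (⨂[ℂ] b, E b) →L[ℂ] ℂ) :
    E false →L[ℂ] E true →L[ℂ] ℂ :=
  LinearMap.mkContinuous₂
    (LinearMap.mk₂ ℂ (fun x y => Ψ (pairTensor x y))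
      (fun x x' y => by rw [pairTensor_add_left, map_add])
      (fun c x y => by rw [pairTensor_smul_left, map_smul])
      (fun x y y' => by rw [pairTensor_add_right, map_add])
      (fun c x y => by rw [pairTensor_smul_right, map_smul])) ‖Ψ‖ fun x y => by
    rw [mul_assoc]
    exact (Ψ.le_opNorm _).trans (by gcongr; exact norm_pairTensor_le x y)

end Pairing

/-! ### Duality for `X ⊗̂ Y` -/

section ProjTensor

variable {X Y Z : Type u} [NormedAddCommGroup X] [NormedSpace ℂ X]
    [NormedAddCommGroup Y] [NormedSpace ℂ Y] [NormedAddCommGroup Z] [NormedSpace ℂ Z]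

/-- The pure tensor `x ⊗ y`. -/
def ProjTensor.pure (x : X) (y : Y) : ProjTensor X Y :=
  pairTensor (E := PairFam X Y) x y

/-- Continuous linear maps on `X ⊗̂ Y` agree if they agree on pure tensors. -/
theorem ProjTensor.ext {F : Type*} [NormedAddCommGroup F] [NormedSpace ℂ F]
    {f g : ProjTensor X Y →L[ℂ] F} (h : ∀ (x : X) (y : Y), f (pure x y) = g (pure x y)) :
    f = g :=
  completion_tprod_ext fun v => by
    rw [← pairTuple_eta v]
    exact h (v false) (v true)

/-- The functional on `X ⊗̂ Y` given by a bounded bilinear form. -/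
def ProjTensor.functional (Λ : Y →L[ℂ] X →L[ℂ] ℂ) : ProjTensor X Y →L[ℂ] ℂ :=
  liftCompletion (pairMultilinear (E := PairFam X Y) Λ)

theorem ProjTensor.functional_pure (Λ : Y →L[ℂ] X →L[ℂ] ℂ) (x : X) (y : Y) :
    functional Λ (pure x y) = Λ y x :=
  liftCompletion_tprod (pairMultilinear (E := PairFam X Y) Λ) _

/-- A functional on `X ⊗̂ Y` as a bounded bilinear form. -/
def ProjTensor.curry (Ψ : ProjTensor X Y →L[ℂ] ℂ) : X →L[ℂ] Y →L[ℂ] ℂ :=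
  curryPairTensor (E := PairFam X Y) Ψ

theorem ProjTensor.curry_apply (Ψ : ProjTensor X Y →L[ℂ] ℂ) (x : X) (y : Y) :
    curry Ψ x y = Ψ (pure x y) := rfl

theorem ProjTensor.idMap_pure (f : Y →L[ℂ] Z) (x : X) (y : Y) :
    ProjTensor.idMap X f (pure x y) = pure x (f y) := by
  refine (ContinuousLinearMap.completion_apply_coe _ _).trans ?_
  rw [PiTensorProduct.mapL_apply, PiTensorProduct.map_tprod]
  refine congrArg (fun v => ((PiTensorProduct.tprod ℂ v : ⨂[ℂ] b, PairFam X Z b) :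
    ProjTensor X Z)) ?_
  funext b; cases b <;> rfl

theorem ProjTensor.functional_idMap (Λ : Z →L[ℂ] X →L[ℂ] ℂ) (f : Y →L[ℂ] Z) (t : ProjTensor X Y) :
    functional Λ (idMap X f t) = functional (Λ.comp f) t := by
  have : (functional Λ).comp (idMap X f) = functional (Λ.comp f) :=
    ProjTensor.ext fun x y => by
      rw [ContinuousLinearMap.comp_apply, idMap_pure, functional_pure, functional_pure,
        ContinuousLinearMap.comp_apply]
  rw [← this, ContinuousLinearMap.comp_apply]

theorem ProjTensor.functional_zero : functional (0 : Y →L[ℂ] X →L[ℂ] ℂ) = 0 :=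
  ProjTensor.ext fun x y => by rw [functional_pure]; simp

end ProjTensor

/-- A functional that vanishes on the kernel of an operator with closed range factors through
this operator. -/
theorem exists_factor_of_isClosed_range {E F : Type*} [NormedAddCommGroup E] [NormedSpace ℂ E]
    [CompleteSpace E] [NormedAddCommGroup F] [NormedSpace ℂ F] [CompleteSpace F]
    (T : E →L[ℂ] F) (hT : IsClosed (Set.range T)) (Φ : E →L[ℂ] ℂ)
    (hΦ : ∀ x, T x = 0 → Φ x = 0) : ∃ Ψ : F →L[ℂ] ℂ, ∀ x, Ψ (T x) = Φ x := by
  have hcl : IsClosed (LinearMap.range (T : E →ₗ[ℂ] F) : Set F) := hT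
  have : CompleteSpace (LinearMap.range (T : E →ₗ[ℂ] F)) := hcl.completeSpace_coe
  let T' : E →L[ℂ] LinearMap.range (T : E →ₗ[ℂ] F) :=
    T.codRestrict _ fun x => LinearMap.mem_range_self _ x
  have hsurj : Function.Surjective T' := by
    rintro ⟨_, x, rfl⟩
    exact ⟨x, rfl⟩
  -- Open mapping theorem for T onto its closed range. The chosen preimages σ need not be linear,
  -- but Φ ∘ σ is, since Φ kills ker T.
  obtain ⟨K, hK, hpre⟩ := T'.exists_preimage_norm_le hsurj
  choose σ hσ hσn using hpre
  have key : ∀ x y, T' x = T' y → Φ x = Φ y := fun x y h => by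
    rw [← sub_eq_zero, ← map_sub]
    refine hΦ _ ?_
    rw [map_sub, sub_eq_zero]
    exact congrArg Subtype.val h
  let Ψ₀ : LinearMap.range (T : E →ₗ[ℂ] F) →L[ℂ] ℂ :=
    LinearMap.mkContinuous
      { toFun := fun y => Φ (σ y)
        map_add' := fun y z => by
          rw [← map_add]
          exact key _ _ (by rw [map_add, hσ, hσ, hσ])
        map_smul' := fun c y => by
          rw [RingHom.id_apply, ← map_smul]
          exact key _ _ (by rw [map_smul, hσ, hσ]) } (‖Φ‖ * K) fun y => by
        rw [mul_assoc]
        exact (Φ.le_opNorm _).trans (by gcongr; exact hσn y)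
  -- Hahn–Banach, from the range to all of F.
  obtain ⟨Ψ, hΨ, -⟩ := exists_extension_norm_eq _ Ψ₀
  refine ⟨Ψ, fun x => ?_⟩
  have := hΨ (T' x)
  exact this.trans (key _ _ (hσ _))

/-! ### Splitting the dual bar complex -/

section BarSplitting

variable (A : Type u) [NonUnitalNormedRing A] [NormedSpace ℂ A] [SMulCommClass ℂ A A]
  [IsScalarTower ℂ A A]

/-- Bounded `(n+1)`-linear functionals. -/
abbrev Cochains (n : ℕ) : Type u := ContinuousMultilinearMap ℂ (fun _ : Fin (n + 1) => A) ℂ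

variable {A}

theorem face_tprod {n : ℕ} (i : Fin (n + 1)) (a : Fin (n + 2) → A) :
    face i ((PiTensorProduct.tprod ℂ a : ⨂[ℂ] _ : Fin (n + 2), A) : Chains A (n + 1)) =
      ((PiTensorProduct.tprod ℂ (faceTuple i a) : ⨂[ℂ] _ : Fin (n + 1), A) : Chains A n) := by
  rw [face]
  erw [ContinuousLinearMap.completion_apply_coe]
  simp [PiTensorProduct.liftEquiv, faceMultilinear]

theorem barDiff_tprod {n : ℕ} (a : Fin (n + 2) → A) :
    barDiff A n ((PiTensorProduct.tprod ℂ a : ⨂[ℂ] _ : Fin (n + 2), A) : Chains A (n + 1)) =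
      ∑ i : Fin (n + 1), (-1 : ℂ) ^ (i : ℕ) •
        ((PiTensorProduct.tprod ℂ (faceTuple i a) : ⨂[ℂ] _ : Fin (n + 1), A) : Chains A n) := by
  simp only [barDiff, sum_apply, smul_apply, face_tprod]

variable (A) in
/-- The cocycles of the dual bar complex. -/
def barCocycles (n : ℕ) : Submodule ℂ (Cochains A n) where
  carrier := {z | ∀ a : Fin (n + 2) → A,
    ∑ i : Fin (n + 1), (-1 : ℂ) ^ (i : ℕ) * z (faceTuple i a) = 0}
  zero_mem' a := by simp
  add_mem' {x y} hx hy a := by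
    simp only [add_apply, mul_add, Finset.sum_add_distrib]
    rw [hx a, hy a, add_zero]
  smul_mem' c x hx a := by
    simp only [smul_apply, smul_eq_mul, mul_left_comm _ c]
    rw [← Finset.mul_sum, hx a, mul_zero]

/-- Closedness makes the cocycle space complete, so that it can serve as the test space X in strong
H-unitality. -/
theorem isClosed_barCocycles (n : ℕ) : IsClosed (barCocycles A n : Set (Cochains A n)) := by
  have : (barCocycles A n : Set (Cochains A n)) = ⋂ a : Fin (n + 2) → A,
      {z | ∑ i : Fin (n + 1), (-1 : ℂ) ^ (i : ℕ) * z (faceTuple i a) = 0} := by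
    ext z; simp [barCocycles]
  rw [this]
  refine isClosed_iInter fun a => isClosed_eq ?_ continuous_const
  refine continuous_finsetSum _ fun i _ => continuous_const.mul ?_
  exact (ContinuousMultilinearMap.apply ℂ (fun _ : Fin (n + 1) => A) ℂ (faceTuple i a)).continuous

/-! ### Families of bar cocycles parametrized by a Banach space -/

section Evaluation

variable {X : Type u} [NormedAddCommGroup X] [NormedSpace ℂ X] {n : ℕ} (j : X →L[ℂ] Cochains A n)

/-- The pairing with chains of the cochains parametrized by `X`. -/
def evalChain : Chains A n →L[ℂ] X →L[ℂ] ℂ :=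
  liftCompletion (ContinuousLinearMap.flipMultilinear j)

theorem evalChain_tprod (a : Fin (n + 1) → A) (x : X) :
    evalChain j ((PiTensorProduct.tprod ℂ a : ⨂[ℂ] _ : Fin (n + 1), A) : Chains A n) x =
      j x a := by
  rw [evalChain, liftCompletion_tprod]
  rfl

variable {j}

theorem evalChain_comp_barDiff (hj : ∀ x, j x ∈ barCocycles A n) :
    (evalChain j).comp (barDiff A n) = 0 := by
  refine completion_tprod_ext fun a => ?_
  ext x
  simp only [ContinuousLinearMap.comp_apply, barDiff_tprod, map_sum, map_smul,
    sum_apply, smul_apply, evalChain_tprod, smul_eq_mul, zero_apply]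
  exact hj x a

theorem functional_evalChain_idMap (hj : ∀ x, j x ∈ barCocycles A n) (t) :
    ProjTensor.functional (evalChain j) (ProjTensor.idMap X (barDiff A n) t) = 0 := by
  rw [ProjTensor.functional_idMap, evalChain_comp_barDiff hj, ProjTensor.functional_zero,
    zero_apply]

/-- Each x ⊗ a is a boundary by surjectivity at the end of the complex, and the pairing kills
boundaries. -/
theorem eq_zero_of_forall_mem_barCocycles [CompleteSpace X] (hA : StronglyHUnital A)
    {j : X →L[ℂ] Cochains A 0} (hj : ∀ x, j x ∈ barCocycles A 0) (x : X) : j x = 0 := by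
  ext a
  obtain ⟨t, ht⟩ := (hA X).1
    (ProjTensor.pure x ((PiTensorProduct.tprod ℂ a : ⨂[ℂ] _ : Fin 1, A) : Chains A 0))
  have := functional_evalChain_idMap hj t
  rwa [ht, ProjTensor.functional_pure, evalChain_tprod] at this

/-- The pairing of X with chains vanishes on the image of id ⊗ β, which is the kernel of the next
differential, so it factors through that differential. The factor, curried in x, is a primitive
depending linearly and boundedly on x. -/
theorem exists_bar_primitive [CompleteSpace X] (hA : StronglyHUnital A)
    {j : X →L[ℂ] Cochains A (n + 1)} (hj : ∀ x, j x ∈ barCocycles A (n + 1)) :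
    ∃ s : X →L[ℂ] Cochains A n, ∀ x, ∀ a : Fin (n + 2) → A,
        ∑ i : Fin (n + 1), (-1 : ℂ) ^ (i : ℕ) * s x (faceTuple i a) = j x a := by
  -- The range is everything in the lowest degree and the kernel of the next differential otherwise.
  have hrange : IsClosed (Set.range (ProjTensor.idMap X (barDiff A n))) := by
    cases n with
    | zero => rw [(hA X).1.range_eq]; exact isClosed_univ
    | succ m =>
      have : Set.range (ProjTensor.idMap X (barDiff A (m + 1))) =
          {x | ProjTensor.idMap X (barDiff A m) x = 0} := by
        ext x; exact ((hA X).2 m x).symm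
      rw [this]
      exact isClosed_eq (ProjTensor.idMap X (barDiff A m)).continuous continuous_const
  obtain ⟨Ψ, hΨ⟩ := exists_factor_of_isClosed_range (ProjTensor.idMap X (barDiff A n)) hrange
    (ProjTensor.functional (evalChain j)) fun x hx => by
      obtain ⟨t, rfl⟩ := ((hA X).2 n x).1 hx
      exact functional_evalChain_idMap hj t
  let ten : ContinuousMultilinearMap ℂ (fun _ : Fin (n + 1) => A) (Chains A n) :=
    (UniformSpace.Completion.toComplL (𝕜 := ℂ)
      (E := ⨂[ℂ] _ : Fin (n + 1), A)).compContinuousMultilinearMap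
      (PiTensorProduct.tprodL ℂ (E := fun _ : Fin (n + 1) => A))
  let s : X →L[ℂ] Cochains A n := LinearMap.mkContinuous
    { toFun := fun x => (ProjTensor.curry Ψ x).compContinuousMultilinearMap ten
      map_add' := fun x y => by ext; simp
      map_smul' := fun c x => by ext; simp } (‖ProjTensor.curry Ψ‖ * ‖ten‖) fun x => by
    refine (ContinuousLinearMap.norm_compContinuousMultilinearMap_le _ _).trans ?_
    rw [mul_right_comm]
    gcongr
    exact (ProjTensor.curry Ψ).le_opNorm x
  refine ⟨s, fun x a => ?_⟩
  have key : ∀ b : Fin (n + 1) → A, s x b = ProjTensor.curry Ψ x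
      ((PiTensorProduct.tprod ℂ b : ⨂[ℂ] _ : Fin (n + 1), A) : Chains A n) := fun b => rfl
  simp only [key]
  have := hΨ (ProjTensor.pure x
    ((PiTensorProduct.tprod ℂ a : ⨂[ℂ] _ : Fin (n + 2), A) : Chains A (n + 1)))
  rw [ProjTensor.idMap_pure, ProjTensor.functional_pure, evalChain_tprod,
    ← ProjTensor.curry_apply, barDiff_tprod] at this
  simpa only [map_sum, map_smul, smul_eq_mul] using this

end Evaluation

/-- A functional that vanishes on products is zero. -/
theorem eq_zero_of_mem_barCocycles_zero (hA : StronglyHUnital A) (z : Cochains A 0)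
    (hz : z ∈ barCocycles A 0) : z = 0 := by
  have : CompleteSpace (barCocycles A 0) := (isClosed_barCocycles 0).completeSpace_coe
  exact eq_zero_of_forall_mem_barCocycles hA (X := barCocycles A 0)
    (j := (barCocycles A 0).subtypeL)
    (fun x => x.2) ⟨z, hz⟩

/-- A strongly H-unital algebra has a split exact dual bar complex. -/
theorem exists_bar_section (hA : StronglyHUnital A) (n : ℕ) :
    ∃ (s : Cochains A (n + 1) →ₗ[ℂ] Cochains A n) (K : ℝ), 0 ≤ K ∧ ∀ z ∈ barCocycles A (n + 1),
      ‖s z‖ ≤ K * ‖z‖ ∧ ∀ a : Fin (n + 2) → A,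
        ∑ i : Fin (n + 1), (-1 : ℂ) ^ (i : ℕ) * s z (faceTuple i a) = z a := by
  have : CompleteSpace (barCocycles A (n + 1)) := (isClosed_barCocycles _).completeSpace_coe
  -- With X the cocycle space and j its inclusion, one application chooses primitives for all
  -- cocycles at once, linearly and boundedly.
  obtain ⟨t, ht⟩ := exists_bar_primitive hA (X := barCocycles A (n + 1))
    (j := (barCocycles A (n + 1)).subtypeL)
    (fun x => x.2)
  -- This extension off the cocycles is purely algebraic; the bound is needed only on cocycles.
  obtain ⟨s, hs⟩ := LinearMap.exists_extend (t : barCocycles A (n + 1) →ₗ[ℂ] Cochains A n)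
  have hs' : ∀ z (hz : z ∈ barCocycles A (n + 1)), s z = t ⟨z, hz⟩ := fun z hz =>
    LinearMap.congr_fun hs ⟨z, hz⟩
  refine ⟨s, ‖t‖, t.opNorm_nonneg, fun z hz => ?_⟩
  rw [hs' z hz]
  exact ⟨t.le_opNorm ⟨z, hz⟩, ht ⟨z, hz⟩⟩

end BarSplitting

/-! ### Hochschild differentials on functions of words -/

section Words

variable {B : Type*} [Mul B]

/-- The dual bar differential of a function of words:
`(x₀, …, xₙ) ↦ ∑_{i < n} (-1)^i f (x₀, …, xᵢ xᵢ₊₁, …, xₙ)`. -/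
def bar : (List B → ℂ) → List B → ℂ
  | _, [] => 0
  | _, [_] => 0
  | f, x :: y :: l => f (x * y :: l) - bar (fun m => f (x :: m)) (y :: l)

@[simp] theorem bar_nil (f : List B → ℂ) : bar f [] = 0 := by simp [bar]

@[simp] theorem bar_singleton (f : List B → ℂ) (x : B) : bar f [x] = 0 := by simp [bar]

theorem bar_cons_cons (f : List B → ℂ) (x y : B) (l : List B) :
    bar f (x :: y :: l) = f (x * y :: l) - bar (fun m => f (x :: m)) (y :: l) := by
  rw [bar]

theorem bar_congr {f g : List B → ℂ} {l : List B}
    (h : ∀ m : List B, m.length + 1 = l.length → f m = g m) : bar f l = bar g l := by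
  induction l generalizing f g with
  | nil => simp
  | cons x l ih =>
    cases l with
    | nil => simp
    | cons y l =>
      rw [bar_cons_cons, bar_cons_cons, h _ (by simp),
        ih fun m hm => h _ (by simpa using hm)]

theorem bar_add (f g : List B → ℂ) (l : List B) :
    bar (fun m => f m + g m) l = bar f l + bar g l := by
  induction l generalizing f g with
  | nil => simp
  | cons x l ih =>
    cases l with
    | nil => simp
    | cons y l => rw [bar_cons_cons, bar_cons_cons, bar_cons_cons, ih]; ring

theorem bar_const_mul (c : ℂ) (f : List B → ℂ) (l : List B) :
    bar (fun m => c * f m) l = c * bar f l := by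
  induction l generalizing f with
  | nil => simp
  | cons x l ih =>
    cases l with
    | nil => simp
    | cons y l => rw [bar_cons_cons, bar_cons_cons, ih]; ring

theorem bar_sub (f g : List B → ℂ) (l : List B) :
    bar (fun m => f m - g m) l = bar f l - bar g l := by
  have := bar_add f (fun m => (-1) * g m) l
  rw [bar_const_mul] at this
  rw [sub_eq_add_neg, ← neg_one_mul (bar g l), ← this]
  exact bar_congr fun m _ => by ring

theorem bar_eq_zero {f : List B → ℂ} {l : List B}
    (h : ∀ m : List B, m.length + 1 = l.length → f m = 0) : bar f l = 0 := by
  rw [bar_congr (g := fun m => 0 * f m) fun m hm => by rw [h m hm, zero_mul], bar_const_mul,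
    zero_mul]

theorem bar_map {A : Type*} [Mul A] {φ : A → B} (hφ : ∀ a b, φ (a * b) = φ a * φ b)
    (f : List B → ℂ) (l : List A) : bar f (l.map φ) = bar (fun m => f (m.map φ)) l := by
  induction l generalizing f with
  | nil => simp
  | cons x l ih =>
    cases l with
    | nil => simp
    | cons y l =>
      rw [List.map_cons, List.map_cons, bar_cons_cons, bar_cons_cons, ← List.map_cons, ih]
      simp [hφ]

/-- The recursion of `bar` peels faces off the left end; this peels off the rightmost face, as the
cyclic term of `hoch` requires. -/
theorem bar_append_pair (f : List B → ℂ) (l : List B) (u z : B) :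
    bar f (l ++ [u, z]) =
      bar (fun m => f (m ++ [z])) (l ++ [u]) + (-1) ^ l.length * f (l ++ [u * z]) := by
  induction l generalizing f with
  | nil => simp [bar_cons_cons]
  | cons x l ih =>
    have := ih fun m => f (x :: m)
    cases l with
    | nil =>
      simp only [List.nil_append, List.cons_append] at this ⊢
      rw [bar_cons_cons, this, bar_cons_cons]
      simp [sub_eq_add_neg]
    | cons y l =>
      simp only [List.cons_append] at this ⊢
      rw [bar_cons_cons, bar_cons_cons, this]
      simp only [List.length_cons, List.cons_append, List.append_assoc, List.nil_append, pow_succ]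
      ring

/-- Multiplication of the first letter of a word from the left. -/
def mulHead (z : B) : List B → List B
  | [] => []
  | x :: m => z * x :: m

theorem bar_mulHead (hassoc : ∀ x y z : B, x * y * z = x * (y * z)) (f : List B → ℂ)
    (z x : B) (m : List B) : bar (fun l => f (mulHead z l)) (x :: m) = bar f (z * x :: m) := by
  cases m with
  | nil => simp
  | cons y m => rw [bar_cons_cons, bar_cons_cons, hassoc]; rfl

/-- On nonempty m one has bar f (x :: m) = f (x · m) - bar (f (x :: ·)) m, where x · m multiplies
the first letter by x. The first term cancels the leading face by associativity, and the second is
covered by induction. -/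
theorem bar_bar (hassoc : ∀ x y z : B, x * y * z = x * (y * z)) (f : List B → ℂ) (l : List B) :
    bar (bar f) l = 0 := by
  induction l generalizing f with
  | nil => simp
  | cons x l ih =>
    cases l with
    | nil => simp
    | cons y l =>
      rw [bar_cons_cons]
      cases l with
      | nil => simp
      | cons z l =>
        have : bar (fun m => bar f (x :: m)) (y :: z :: l) =
            bar (fun m => f (mulHead x m) - bar (fun m => f (x :: m)) m) (y :: z :: l) := by
          refine bar_congr fun m hm => ?_
          cases m with
          | nil => simp at hm
          | cons w m => rw [bar_cons_cons]; rfl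
        rw [this, bar_sub, bar_mulHead hassoc, ih]
        ring

/-- `(x₀, …, xₙ₊₁) ↦ (xₙ₊₁ x₀, x₁, …, xₙ)`. -/
def rot : List B → List B
  | [] => []
  | x :: m => m.getLastD x * x :: m.dropLast

@[simp] theorem rot_cons_append (x z : B) (m : List B) :
    rot (x :: (m ++ [z])) = z * x :: m := by
  simp [rot]

/-- The Hochschild differential of a function of words. -/
def hoch (f : List B → ℂ) (l : List B) : ℂ :=
  bar f l + (-1) ^ (l.length + 1) * f (rot l)

/-- The bound matters: `rot [x] = [x * x]` is not shorter. Hence the recurring length assumptions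
for `hoch`. -/
theorem length_rot {l : List B} (hl : 2 ≤ l.length) : (rot l).length + 1 = l.length := by
  cases l with
  | nil => simp at hl
  | cons x l => simp [rot] at hl ⊢; omega

omit [Mul B] in
theorem exists_eq_cons_append {l : List B} (hl : 2 ≤ l.length) :
    ∃ x m z, l = x :: (m ++ [z]) := by
  cases l with
  | nil => simp at hl
  | cons x l =>
    rcases List.eq_nil_or_concat l with rfl | ⟨m, z, rfl⟩
    · simp at hl
    · exact ⟨x, m, z, by simp⟩

theorem hoch_congr {f g : List B → ℂ} {l : List B} (hl : 2 ≤ l.length)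
    (h : ∀ m : List B, m.length + 1 = l.length → f m = g m) : hoch f l = hoch g l := by
  rw [hoch, hoch, bar_congr h, h _ (length_rot hl)]

theorem hoch_add (f g : List B → ℂ) (l : List B) :
    hoch (fun m => f m + g m) l = hoch f l + hoch g l := by
  simp only [hoch, bar_add]; ring

theorem hoch_sub (f g : List B → ℂ) (l : List B) :
    hoch (fun m => f m - g m) l = hoch f l - hoch g l := by
  simp only [hoch, bar_sub]; ring

theorem hoch_eq_zero {f : List B → ℂ} {l : List B} (hl : 2 ≤ l.length)
    (h : ∀ m : List B, m.length + 1 = l.length → f m = 0) : hoch f l = 0 := by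
  rw [hoch, bar_eq_zero h, h _ (length_rot hl)]; simp

theorem hoch_map {A : Type*} [Mul A] {φ : A → B} (hφ : ∀ a b, φ (a * b) = φ a * φ b)
    (f : List B → ℂ) {l : List A} (hl : 2 ≤ l.length) :
    hoch f (l.map φ) = hoch (fun m => f (m.map φ)) l := by
  obtain ⟨x, m, z, rfl⟩ := exists_eq_cons_append hl
  have : rot ((x :: (m ++ [z])).map φ) = (z * x :: m).map φ := by simp [hφ]
  rw [hoch, hoch, bar_map hφ, this, rot_cons_append, List.length_map]

/-- Since bar ∘ bar = 0, only terms with a cyclic face remain. The bar differential of f ∘ rot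
splits into the faces of the rotated word and the doubly rotated term; both occur in `hoch f` of the
rotated word with the opposite sign. -/
theorem hoch_hoch (hassoc : ∀ x y z : B, x * y * z = x * (y * z)) (f : List B → ℂ) {l : List B}
    (hl : 3 ≤ l.length) : hoch (hoch f) l = 0 := by
  obtain ⟨x, m, z, rfl⟩ := exists_eq_cons_append (show 2 ≤ l.length by omega)
  rcases List.eq_nil_or_concat m with rfl | ⟨m, u, rfl⟩
  · simp at hl
  rw [List.concat_eq_append]
  have h1 : bar (hoch f) (x :: (m ++ [u] ++ [z])) =
      (-1) ^ (m.length + 1) * bar (fun l => f (rot l)) (x :: (m ++ [u] ++ [z])) := by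
    have : bar (hoch f) (x :: (m ++ [u] ++ [z])) = bar (fun l => bar f l +
        (-1) ^ (m.length + 1) * f (rot l)) (x :: (m ++ [u] ++ [z])) := by
      refine bar_congr fun l hl => ?_
      have hl' : l.length + 1 = m.length + 1 + 2 := by
        simpa using hl
      rw [hoch, hl', pow_add _ _ 2]
      simp
    rw [this, bar_add, bar_const_mul]
    have := bar_bar hassoc f (x :: (m ++ [u] ++ [z]))
    rw [show bar (fun l => bar f l) (x :: (m ++ [u] ++ [z])) = 0 from this, zero_add]
  have h2 : bar (fun l => f (rot l)) (x :: (m ++ [u] ++ [z])) =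
      bar f (z * x :: (m ++ [u])) + (-1) ^ (m.length + 1) * f (u * z * x :: m) := by
    have := bar_append_pair (fun l => f (rot l)) (x :: m) u z
    have e : x :: m ++ [u, z] = x :: (m ++ [u] ++ [z]) := by simp
    rw [e] at this
    rw [this]
    have h3 : bar (fun l => f (rot (l ++ [z]))) (x :: m ++ [u]) =
        bar (fun l => f (mulHead z l)) (x :: (m ++ [u])) := by
      refine bar_congr fun l hl => ?_
      cases l with
      | nil => simp at hl
      | cons y l => rw [List.cons_append, rot_cons_append]; rfl
    rw [h3, bar_mulHead hassoc, List.cons_append, rot_cons_append]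
    simp
  rw [hoch, h1, h2, rot_cons_append, hoch, rot_cons_append, hassoc]
  simp only [List.length_cons, List.length_append, List.length_nil]
  simp only [pow_add, pow_one]
  ring

end Words

/-! ### Bounded multilinear functions of words -/

/-- The multiplication of `B` is associative, bilinear, and submultiplicative. -/
structure IsBanachMul (B : Type*) [NormedAddCommGroup B] [NormedSpace ℂ B] [Mul B] : Prop where
  assoc : ∀ x y z : B, x * y * z = x * (y * z)
  add_mul : ∀ x y z : B, (x + y) * z = x * z + y * z
  mul_add : ∀ x y z : B, x * (y + z) = x * y + x * z
  smul_mul : ∀ (c : ℂ) (x y : B), (c • x) * y = c • (x * y)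
  mul_smul : ∀ (c : ℂ) (x y : B), x * (c • y) = c • (x * y)
  norm_mul_le : ∀ x y : B, ‖x * y‖ ≤ ‖x‖ * ‖y‖

section Multilinear

variable {B : Type*} [NormedAddCommGroup B]

/-- The product of the norms of the letters of a word. -/
def wordNorm (l : List B) : ℝ := (l.map norm).prod

theorem wordNorm_nonneg (l : List B) : 0 ≤ wordNorm l :=
  List.prod_nonneg (by simp +contextual [List.mem_map])

@[simp] theorem wordNorm_nil : wordNorm ([] : List B) = 1 := rfl

@[simp] theorem wordNorm_cons (x : B) (l : List B) : wordNorm (x :: l) = ‖x‖ * wordNorm l := by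
  simp [wordNorm]

@[simp] theorem wordNorm_append (l m : List B) :
    wordNorm (l ++ m) = wordNorm l * wordNorm m := by
  simp [wordNorm]

variable [NormedSpace ℂ B]

/-- The restriction of `f` to words of length `n` is multilinear and bounded. -/
structure IsMultilinearOn (n : ℕ) (f : List B → ℂ) : Prop where
  add : ∀ x y a b, x.length + y.length + 1 = n →
    f (x ++ (a + b) :: y) = f (x ++ a :: y) + f (x ++ b :: y)
  smul : ∀ x y (c : ℂ) a, x.length + y.length + 1 = n →
    f (x ++ (c • a) :: y) = c * f (x ++ a :: y)
  bound : ∃ K, 0 ≤ K ∧ ∀ l : List B, l.length = n → ‖f l‖ ≤ K * wordNorm l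

namespace IsMultilinearOn

variable {n : ℕ} {f g : List B → ℂ}

theorem add_fun (hf : IsMultilinearOn n f) (hg : IsMultilinearOn n g) :
    IsMultilinearOn n fun l => f l + g l where
  add x y a b h := by rw [hf.add x y a b h, hg.add x y a b h]; ring
  smul x y c a h := by rw [hf.smul x y c a h, hg.smul x y c a h]; ring
  bound := by
    obtain ⟨K, hK, h⟩ := hf.bound
    obtain ⟨K', hK', h'⟩ := hg.bound
    exact ⟨K + K', by positivity, fun l hl => (norm_add_le _ _).trans
      ((add_le_add (h l hl) (h' l hl)).trans (by rw [add_mul]))⟩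

theorem const_mul (hf : IsMultilinearOn n f) (c : ℂ) : IsMultilinearOn n fun l => c * f l where
  add x y a b h := by rw [hf.add x y a b h]; ring
  smul x y d a h := by rw [hf.smul x y d a h]; ring
  bound := by
    obtain ⟨K, hK, h⟩ := hf.bound
    refine ⟨‖c‖ * K, by positivity, fun l hl => ?_⟩
    rw [norm_mul, mul_assoc]
    gcongr
    exact h l hl

theorem sub_fun (hf : IsMultilinearOn n f) (hg : IsMultilinearOn n g) :
    IsMultilinearOn n fun l => f l - g l := by
  simpa only [neg_one_mul, ← sub_eq_add_neg] using hf.add_fun (hg.const_mul (-1))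

theorem zero_fun : IsMultilinearOn n fun _ : List B => (0 : ℂ) where
  add := by simp
  smul := by simp
  bound := ⟨0, le_rfl, by simp⟩

theorem cons (hf : IsMultilinearOn (n + 1) f) (x : B) :
    IsMultilinearOn n fun l => f (x :: l) where
  add l m a b h := by
    rw [← List.cons_append, ← List.cons_append, ← List.cons_append]
    exact hf.add (x :: l) m a b (by simp; omega)
  smul l m c a h := by
    rw [← List.cons_append, ← List.cons_append]
    exact hf.smul (x :: l) m c a (by simp; omega)
  bound := by
    obtain ⟨K, hK, h⟩ := hf.bound
    refine ⟨K * ‖x‖, by positivity, fun l hl => (h _ (by simpa using hl)).trans ?_⟩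
    rw [wordNorm_cons, mul_assoc]

theorem map_zero (hf : IsMultilinearOn n f) {x y : List B} (h : x.length + y.length + 1 = n) :
    f (x ++ 0 :: y) = 0 := by
  have := hf.smul x y 0 0 h
  rwa [zero_smul, zero_mul] at this

variable [Mul B] (hB : IsBanachMul B)
include hB

/-- A varied letter either passes through a face unchanged or enters one product, where
distributivity applies. The recursion on the prefix separates these cases. -/
theorem bar_add_letter (hf : IsMultilinearOn n f) (x y : List B) (a b : B)
    (h : x.length + y.length = n) :
    bar f (x ++ (a + b) :: y) = bar f (x ++ a :: y) + bar f (x ++ b :: y) := by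
  induction x generalizing f n with
  | nil =>
    cases y with
    | nil => simp
    | cons c y =>
      simp only [List.nil_append, bar_cons_cons, hB.add_mul]
      have h1 := hf.add [] y (a * c) (b * c) (by simpa using h)
      simp only [List.nil_append] at h1
      have h2 : bar (fun m => f ((a + b) :: m)) (c :: y) =
          bar (fun m => f (a :: m) + f (b :: m)) (c :: y) :=
        bar_congr fun m hm => hf.add [] m a b (by simp at hm h ⊢; omega)
      rw [h1, h2, bar_add]
      ring
  | cons x₀ x ih =>
    cases n with
    | zero => simp at h
    | succ n =>
      have h1 := ih (hf.cons x₀) (by simp at h; omega)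
      cases x with
      | nil =>
        simp only [List.nil_append, List.cons_append, bar_cons_cons, hB.mul_add] at h1 ⊢
        have h2 := hf.add [] y (x₀ * a) (x₀ * b) (by simp at h ⊢; omega)
        simp only [List.nil_append] at h2
        rw [h1, h2]; ring
      | cons x₁ x =>
        simp only [List.cons_append, bar_cons_cons] at h1 ⊢
        have h2 := hf.add (x₀ * x₁ :: x) y a b (by simp at h ⊢; omega)
        simp only [List.cons_append] at h2
        rw [h1, h2]; ring

theorem bar_smul_letter (hf : IsMultilinearOn n f) (x y : List B) (c : ℂ) (a : B)
    (h : x.length + y.length = n) :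
    bar f (x ++ (c • a) :: y) = c * bar f (x ++ a :: y) := by
  induction x generalizing f n with
  | nil =>
    cases y with
    | nil => simp
    | cons b y =>
      simp only [List.nil_append, bar_cons_cons, hB.smul_mul]
      have h1 := hf.smul [] y c (a * b) (by simpa using h)
      simp only [List.nil_append] at h1
      have h2 : bar (fun m => f ((c • a) :: m)) (b :: y) =
          bar (fun m => c * f (a :: m)) (b :: y) :=
        bar_congr fun m hm => hf.smul [] m c a (by simp at hm h ⊢; omega)
      rw [h1, h2, bar_const_mul]
      ring
  | cons x₀ x ih =>
    cases n with
    | zero => simp at h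
    | succ n =>
      have h1 := ih (hf.cons x₀) (by simp at h; omega)
      cases x with
      | nil =>
        simp only [List.nil_append, List.cons_append, bar_cons_cons, hB.mul_smul] at h1 ⊢
        have h2 := hf.smul [] y c (x₀ * a) (by simp at h ⊢; omega)
        simp only [List.nil_append] at h2
        rw [h1, h2]; ring
      | cons x₁ x =>
        simp only [List.cons_append, bar_cons_cons] at h1 ⊢
        have h2 := hf.smul (x₀ * x₁ :: x) y c a (by simp at h ⊢; omega)
        simp only [List.cons_append] at h2
        rw [h1, h2]; ring

omit [NormedSpace ℂ B] hB in
theorem norm_bar_le (hB : ∀ x y : B, ‖x * y‖ ≤ ‖x‖ * ‖y‖) {f : List B → ℂ} {K : ℝ} (hK : 0 ≤ K)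
    {l : List B} (hf : ∀ m : List B, m.length + 1 = l.length → ‖f m‖ ≤ K * wordNorm m) :
    ‖bar f l‖ ≤ l.length * K * wordNorm l := by
  induction l generalizing f K with
  | nil => simp
  | cons x l ih =>
    cases l with
    | nil => simpa using mul_nonneg hK (norm_nonneg x)
    | cons y l =>
      rw [bar_cons_cons]
      have h1 := ih (f := fun m => f (x :: m)) (K := K * ‖x‖) (by positivity) fun m hm =>
        (hf _ (by simpa using hm)).trans (by rw [wordNorm_cons, mul_assoc])
      have h2 : ‖f (x * y :: l)‖ ≤ K * (‖x‖ * ‖y‖ * wordNorm l) := by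
        refine (hf _ (by simp)).trans ?_
        rw [wordNorm_cons]
        have := wordNorm_nonneg l
        gcongr
        exact hB x y
      refine (norm_sub_le _ _).trans ((add_le_add h2 h1).trans (le_of_eq ?_))
      simp only [wordNorm_cons, List.length_cons, Nat.cast_add, Nat.cast_one]
      ring

theorem bar (hf : IsMultilinearOn n f) : IsMultilinearOn (n + 1) (bar f) where
  add x y a b h := hf.bar_add_letter hB x y a b (by omega)
  smul x y c a h := hf.bar_smul_letter hB x y c a (by omega)
  bound := by
    obtain ⟨K, hK, h⟩ := hf.bound
    -- There are n faces, each bounded by K; the word length n + 1 is used as a convenient upper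
    -- bound.
    refine ⟨(n + 1 : ℕ) * K, by positivity, fun l hl => ?_⟩
    rw [← hl]
    exact norm_bar_le hB.norm_mul_le hK fun m hm => h m (by omega)

theorem comp_rot (hf : IsMultilinearOn (n + 1) f) :
    IsMultilinearOn (n + 2) fun l => f (rot l) where
  add x y a b h := by
    cases x with
    | nil =>
      rcases List.eq_nil_or_concat y with rfl | ⟨m, z, rfl⟩
      · simp at h
      · simp only [List.concat_eq_append, List.nil_append, rot_cons_append, hB.mul_add]
        exact hf.add [] m _ _ (by simp at h ⊢; omega)
    | cons x₀ x =>
      rcases List.eq_nil_or_concat y with rfl | ⟨m, z, rfl⟩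
      · simp only [List.cons_append, rot_cons_append, hB.add_mul]
        exact hf.add [] x _ _ (by simp at h ⊢; omega)
      · have e : ∀ w : B, x₀ :: x ++ w :: m.concat z = x₀ :: (x ++ w :: m ++ [z]) := by simp
        rw [e, e, e, rot_cons_append, rot_cons_append, rot_cons_append]
        exact hf.add (z * x₀ :: x) m _ _ (by simp at h ⊢; omega)
  smul x y c a h := by
    cases x with
    | nil =>
      rcases List.eq_nil_or_concat y with rfl | ⟨m, z, rfl⟩
      · simp at h
      · simp only [List.concat_eq_append, List.nil_append, rot_cons_append, hB.mul_smul]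
        exact hf.smul [] m _ _ (by simp at h ⊢; omega)
    | cons x₀ x =>
      rcases List.eq_nil_or_concat y with rfl | ⟨m, z, rfl⟩
      · simp only [List.cons_append, rot_cons_append, hB.smul_mul]
        exact hf.smul [] x _ _ (by simp at h ⊢; omega)
      · have e : ∀ w : B, x₀ :: x ++ w :: m.concat z = x₀ :: (x ++ w :: m ++ [z]) := by simp
        rw [e, e, rot_cons_append, rot_cons_append]
        exact hf.smul (z * x₀ :: x) m _ _ (by simp at h ⊢; omega)
  bound := by
    obtain ⟨K, hK, h⟩ := hf.bound
    refine ⟨K, hK, fun l hl => ?_⟩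
    obtain ⟨x, m, z, rfl⟩ := exists_eq_cons_append (show 2 ≤ l.length by omega)
    rw [rot_cons_append]
    refine (h _ (by simp at hl ⊢; omega)).trans ?_
    have := wordNorm_nonneg m
    simp only [wordNorm_cons, wordNorm_append, wordNorm_nil, mul_one]
    calc K * (‖z * x‖ * wordNorm m) ≤ K * (‖z‖ * ‖x‖ * wordNorm m) := by
          gcongr; exact hB.norm_mul_le z x
      _ = K * (‖x‖ * (wordNorm m * ‖z‖)) := by ring

theorem hoch (hf : IsMultilinearOn (n + 1) f) : IsMultilinearOn (n + 2) (hoch f) := by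
  have h := (hf.bar hB).add_fun ((hf.comp_rot hB).const_mul ((-1) ^ (n + 2 + 1)))
  constructor
  · intro x y a b hl
    have := h.add x y a b hl
    have e : ∀ w, (x ++ w :: y).length = n + 2 := fun w => by simp; omega
    simpa only [MatrixBanach.hoch, e] using this
  · intro x y c a hl
    have := h.smul x y c a hl
    have e : ∀ w, (x ++ w :: y).length = n + 2 := fun w => by simp; omega
    simpa only [MatrixBanach.hoch, e] using this
  · obtain ⟨K, hK, hb⟩ := h.bound
    refine ⟨K, hK, fun l hl => ?_⟩
    rw [MatrixBanach.hoch, hl]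
    exact hb l hl

end IsMultilinearOn

end Multilinear

/-! ### Words and continuous multilinear maps -/

theorem bar_ofFn {B : Type*} [Mul B] (f : List B → ℂ) {n : ℕ} (a : Fin (n + 2) → B) :
    bar f (List.ofFn a) =
      ∑ i : Fin (n + 1), (-1 : ℂ) ^ (i : ℕ) * f (List.ofFn (faceTuple i a)) := by
  induction n generalizing f with
  | zero =>
    simp [List.ofFn_succ, bar_cons_cons, faceTuple, Fin.contractNth]
  | succ n ih =>
    have e0 : List.ofFn (faceTuple 0 a) = a 0 * a 1 :: List.ofFn fun i => a (Fin.succ (Fin.succ i)) := by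
      rw [List.ofFn_succ]
      simp [faceTuple, Fin.contractNth]
    have e1 : ∀ i : Fin (n + 1), List.ofFn (faceTuple i.succ a) =
        a 0 :: List.ofFn (faceTuple i fun i => a (Fin.succ i)) := fun i => by
      rw [List.ofFn_succ]
      simp [faceTuple, Fin.contractNth, -Fin.val_fin_lt]
    rw [Fin.sum_univ_succ, e0]
    simp only [e1]
    rw [List.ofFn_succ, List.ofFn_succ, bar_cons_cons, ← List.ofFn_succ (f := fun i => a (Fin.succ i)),
      ih]
    simp [pow_succ, sub_eq_add_neg]

section Conversion

variable {E : Type*} [NormedAddCommGroup E] [NormedSpace ℂ E]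

theorem IsMultilinearOn.lin {n : ℕ} {f : List E → ℂ} (hf : IsMultilinearOn n f) (x y : List E)
    (c : ℂ) (a b : E) (h : x.length + y.length + 1 = n) :
    f (x ++ (c • a + b) :: y) = c * f (x ++ a :: y) + f (x ++ b :: y) := by
  rw [hf.add _ _ _ _ h, hf.smul _ _ _ _ h]

theorem IsMultilinearOn.of_lin {n : ℕ} {f : List E → ℂ}
    (h : ∀ x y (c : ℂ) a b, x.length + y.length + 1 = n →
      f (x ++ (c • a + b) :: y) = c * f (x ++ a :: y) + f (x ++ b :: y))
    (hb : ∃ K, 0 ≤ K ∧ ∀ l : List E, l.length = n → ‖f l‖ ≤ K * wordNorm l) :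
    IsMultilinearOn n f where
  add x y a b hl := by simpa using h x y 1 a b hl
  smul x y c a hl := by
    -- With c = 1 and a = b = 0 the identity reads t = t + t.
    have h0 : f (x ++ 0 :: y) = 0 := by simpa using h x y 1 0 0 hl
    simpa [h0] using h x y c a 0 hl
  bound := hb

/-- A multilinear functional as a function of words. -/
def wordFun {n : ℕ} (D : ContinuousMultilinearMap ℂ (fun _ : Fin n => E) ℂ) (l : List E) : ℂ :=
  D fun i => l.getD i 0

@[simp] theorem wordFun_ofFn {n : ℕ} (D : ContinuousMultilinearMap ℂ (fun _ : Fin n => E) ℂ)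
    (v : Fin n → E) : wordFun D (List.ofFn v) = D v := by
  rw [wordFun]; congr 1; funext i; simp

theorem eq_ofFn_getD {n : ℕ} {l : List E} (hl : l.length = n) :
    l = List.ofFn fun i : Fin n => l.getD i 0 := by
  subst hl; simp

theorem wordNorm_eq_prod {n : ℕ} {l : List E} (hl : l.length = n) :
    wordNorm l = ∏ i : Fin n, ‖l.getD i 0‖ := by
  conv_lhs => rw [eq_ofFn_getD hl]
  rw [wordNorm, List.map_ofFn, List.prod_ofFn]
  rfl

theorem norm_wordFun_le {n : ℕ} (D : ContinuousMultilinearMap ℂ (fun _ : Fin n => E) ℂ)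
    {l : List E} (hl : l.length = n) : ‖wordFun D l‖ ≤ ‖D‖ * wordNorm l := by
  rw [wordNorm_eq_prod hl]
  exact D.le_opNorm _

theorem getD_append_cons {n : ℕ} (x y : List E) (h : x.length + y.length + 1 = n) (a : E) :
    (fun i : Fin n => (x ++ a :: y).getD i 0) =
      Function.update (fun i : Fin n => (x ++ 0 :: y).getD i 0) ⟨x.length, by omega⟩ a := by
  funext i
  rcases lt_trichotomy (i : ℕ) x.length with hi | hi | hi
  · rw [Function.update_of_ne (by simp [Fin.ext_iff]; omega)]
    simp [List.getElem?_append, hi]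
  · rw [show i = ⟨x.length, by omega⟩ from Fin.ext hi]
    simp
  · rw [Function.update_of_ne (by simp [Fin.ext_iff]; omega)]
    obtain ⟨k, hk⟩ : ∃ k, (i : ℕ) = x.length + (k + 1) := ⟨i - x.length - 1, by omega⟩
    simp [hk, List.getElem?_append]

theorem isMultilinearOn_wordFun {n : ℕ}
    (D : ContinuousMultilinearMap ℂ (fun _ : Fin n => E) ℂ) : IsMultilinearOn n (wordFun D) where
  add x y a b h := by
    simp only [wordFun]
    rw [getD_append_cons x y h, getD_append_cons x y h a, getD_append_cons x y h b,
      D.map_update_add]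
  smul x y c a h := by
    simp only [wordFun]
    rw [getD_append_cons x y h, getD_append_cons x y h a, D.map_update_smul, smul_eq_mul]
  bound := ⟨‖D‖, norm_nonneg _, fun l hl => norm_wordFun_le D hl⟩

theorem ofFn_update {n : ℕ} (v : Fin n → E) (i : Fin n) (a : E) :
    List.ofFn (Function.update v i a) =
      (List.ofFn v).take i ++ a :: (List.ofFn v).drop (i + 1) := by
  refine List.ext_getElem (by simp; omega) fun j h1 h2 => ?_
  simp only [List.length_ofFn] at h1
  rcases lt_trichotomy j (i : ℕ) with hj | hj | hj
  · rw [List.getElem_ofFn, Function.update_of_ne (by simp [Fin.ext_iff]; omega),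
      List.getElem_append_left (by simp; omega)]
    simp
  · subst hj
    simp
  · obtain ⟨k, rfl⟩ : ∃ k, j = i + (k + 1) := ⟨j - i - 1, by omega⟩
    rw [List.getElem_ofFn, Function.update_of_ne (by simp [Fin.ext_iff]),
      List.getElem_append_right (by simp)]
    simp only [List.length_take, List.length_ofFn, List.getElem_cons, List.getElem_drop,
      List.getElem_ofFn]
    rw [dif_neg (by omega)]
    congr 2
    omega

open Classical in
/-- The multilinear functional given by a function of words (zero if the function is not bounded
and multilinear on words of length `n`). -/
def cochainOf (n : ℕ) (f : List E → ℂ) : ContinuousMultilinearMap ℂ (fun _ : Fin n => E) ℂ :=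
  if hf : IsMultilinearOn n f then
    MultilinearMap.mkContinuous
      { toFun := fun v => f (List.ofFn v)
        map_update_add' := fun {inst} v i a b => by
          obtain rfl : inst = instDecidableEqFin n := Subsingleton.elim _ _
          simp only [ofFn_update]
          exact hf.add _ _ _ _ (by simp; omega)
        map_update_smul' := fun {inst} v i c a => by
          obtain rfl : inst = instDecidableEqFin n := Subsingleton.elim _ _
          simp only [ofFn_update]
          exact hf.smul _ _ _ _ (by simp; omega) }
      hf.bound.choose fun v => by
        refine (hf.bound.choose_spec.2 _ (by simp)).trans (le_of_eq ?_)
        rw [wordNorm, List.map_ofFn, List.prod_ofFn]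
        rfl
  else 0

theorem cochainOf_apply {n : ℕ} {f : List E → ℂ} (hf : IsMultilinearOn n f) (v : Fin n → E) :
    cochainOf n f v = f (List.ofFn v) := by
  rw [cochainOf, dif_pos hf]; rfl

theorem wordFun_cochainOf {n : ℕ} {f : List E → ℂ} (hf : IsMultilinearOn n f) {l : List E}
    (hl : l.length = n) : wordFun (cochainOf n f) l = f l := by
  subst hl
  rw [wordFun, cochainOf_apply hf]
  congr 1
  simp

theorem norm_cochainOf_le {n : ℕ} {f : List E → ℂ} (hf : IsMultilinearOn n f) {K : ℝ}
    (hK : 0 ≤ K) (h : ∀ l : List E, l.length = n → ‖f l‖ ≤ K * wordNorm l) :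
    ‖cochainOf n f‖ ≤ K := by
  refine ContinuousMultilinearMap.opNorm_le_bound hK fun v => ?_
  rw [cochainOf_apply hf]
  refine (h _ (by simp)).trans (le_of_eq ?_)
  rw [wordNorm, List.map_ofFn, List.prod_ofFn]
  rfl

theorem wordNorm_map_le {F : Type*} [NormedAddCommGroup F] [NormedSpace ℂ F] (φ : E →L[ℂ] F)
    (l : List E) : wordNorm (l.map φ) ≤ ‖φ‖ ^ l.length * wordNorm l := by
  induction l with
  | nil => simp
  | cons x l ih =>
    rw [List.map_cons, wordNorm_cons, wordNorm_cons, List.length_cons, pow_succ]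
    calc ‖φ x‖ * wordNorm (l.map φ) ≤ (‖φ‖ * ‖x‖) * (‖φ‖ ^ l.length * wordNorm l) := by
          gcongr
          · exact wordNorm_nonneg _
          · exact φ.le_opNorm x
      _ = _ := by ring

theorem isCocycle_iff_hoch_wordFun [Mul E] {n : ℕ}
    (D : ContinuousMultilinearMap ℂ (fun _ : Fin (n + 1) => E) ℂ) :
    IsCocycle D ↔ ∀ l : List E, l.length = n + 2 → hoch (wordFun D) l = 0 := by
  have key : ∀ a : Fin (n + 2) → E, hoch (wordFun D) (List.ofFn a) =
      ∑ i : Fin (n + 1), (-1 : ℂ) ^ (i : ℕ) * D (faceTuple i a)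
      + (-1) ^ (n + 1) * D (Function.update (Fin.init a) 0 (a (Fin.last (n + 1)) * a 0)) := by
    intro a
    have e : rot (List.ofFn a) =
        List.ofFn (Function.update (Fin.init a) 0 (a (Fin.last (n + 1)) * a 0)) := by
      rw [List.ofFn_succ, List.ofFn_succ', List.concat_eq_append, rot_cons_append,
        List.ofFn_succ]
      simp [Fin.init]
    rw [hoch, bar_ofFn, e]
    simp only [wordFun_ofFn, List.length_ofFn]
    -- On words of n + 2 letters `hoch` has the exponent n + 3, of the same parity as n + 1.
    rw [show n + 2 + 1 = n + 1 + 2 by omega, pow_add _ _ 2]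
    simp
  constructor
  · intro h l hl
    rw [eq_ofFn_getD hl, key]
    exact h _
  · intro h a
    rw [← key]
    exact h _ (by simp)

end Conversion

/-! ### Primitives along a block of letters -/

section Block

variable {B : Type*} [NormedAddCommGroup B] [NormedSpace ℂ B]

/-- A function of three words as a function of their concatenation. -/
def blockFun (r k : ℕ) (H : List B → List B → List B → ℂ) (l : List B) : ℂ :=
  H (l.take r) ((l.drop r).take k) ((l.drop r).drop k)

theorem blockFun_append {r k : ℕ} (H : List B → List B → List B → ℂ) {y w : List B} (x : List B)
    (hy : y.length = r) (hw : w.length = k) : blockFun r k H (y ++ (w ++ x)) = H y w x := by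
  subst hy hw
  simp [blockFun]

theorem exists_eq_append {l : List B} {m n : ℕ} (h : l.length = m + n) :
    ∃ u v, l = u ++ v ∧ u.length = m ∧ v.length = n :=
  ⟨l.take m, l.drop m, by simp, by simp; omega, by simp; omega⟩

/-- The block lengths are fixed, so a varied letter lies in exactly one of the three blocks. -/
theorem isMultilinearOn_blockFun {r k q : ℕ} {H : List B → List B → List B → ℂ}
    (hy : ∀ u v (c : ℂ) a b w x, u.length + v.length + 1 = r → w.length = k → x.length = q →
      H (u ++ (c • a + b) :: v) w x = c * H (u ++ a :: v) w x + H (u ++ b :: v) w x)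
    (hw : ∀ u v (c : ℂ) a b y x, u.length + v.length + 1 = k → y.length = r → x.length = q →
      H y (u ++ (c • a + b) :: v) x = c * H y (u ++ a :: v) x + H y (u ++ b :: v) x)
    (hx : ∀ u v (c : ℂ) a b y w, u.length + v.length + 1 = q → y.length = r → w.length = k →
      H y w (u ++ (c • a + b) :: v) = c * H y w (u ++ a :: v) + H y w (u ++ b :: v))
    (hb : ∃ K, 0 ≤ K ∧ ∀ y w x : List B, y.length = r → w.length = k → x.length = q →
      ‖H y w x‖ ≤ K * (wordNorm y * (wordNorm w * wordNorm x))) :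
    IsMultilinearOn (r + (k + q)) (blockFun r k H) := by
  refine .of_lin (fun u v c a b h => ?_) ?_
  · rcases lt_or_ge u.length r with h1 | h1
    · obtain ⟨v₁, v', rfl, hv₁, hv'⟩ := exists_eq_append
        (show v.length = (r - u.length - 1) + (k + q) by omega)
      obtain ⟨w, x, rfl, hw', hx'⟩ := exists_eq_append hv'
      have e : ∀ d : B, u ++ d :: (v₁ ++ (w ++ x)) = (u ++ d :: v₁) ++ (w ++ x) := by simp
      have hl : ∀ d : B, (u ++ d :: v₁).length = r := fun d => by simp; omega
      simp only [e, blockFun_append H x (hl _) hw']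
      exact hy _ _ _ _ _ _ _ (by omega) hw' hx'
    · obtain ⟨y, u', rfl, hy', hu'⟩ := exists_eq_append
        (show u.length = r + (u.length - r) by omega)
      rcases lt_or_ge u'.length k with h2 | h2
      · obtain ⟨v₁, x, rfl, hv₁, hx'⟩ := exists_eq_append
          (show v.length = (k - u'.length - 1) + q by simp at h; omega)
        have e : ∀ d : B, y ++ u' ++ d :: (v₁ ++ x) = y ++ ((u' ++ d :: v₁) ++ x) := by simp
        have hl : ∀ d : B, (u' ++ d :: v₁).length = k := fun d => by simp; omega
        simp only [e, blockFun_append H x hy' (hl _)]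
        exact hw _ _ _ _ _ _ _ (by omega) hy' hx'
      · obtain ⟨w, u₂, rfl, hw', hu₂⟩ := exists_eq_append
          (show u'.length = k + (u'.length - k) by omega)
        have e : ∀ d : B, y ++ (w ++ u₂) ++ d :: v = y ++ (w ++ (u₂ ++ d :: v)) := by simp
        simp only [e, blockFun_append H _ hy' hw']
        exact hx _ _ _ _ _ _ _ (by simp at h; omega) hy' hw'
  · obtain ⟨K, hK, hb⟩ := hb
    refine ⟨K, hK, fun l hl => ?_⟩
    obtain ⟨y, v, rfl, hy', hv⟩ := exists_eq_append hl
    obtain ⟨w, x, rfl, hw', hx'⟩ := exists_eq_append hv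
    rw [blockFun_append H x hy' hw', wordNorm_append, wordNorm_append]
    exact hb y w x hy' hw' hx'

/-- Apply a function to the first letter of a word. -/
def mapHead (φ : B → B) : List B → List B
  | [] => []
  | x :: l => φ x :: l

@[simp] theorem length_mapHead (φ : B → B) (l : List B) : (mapHead φ l).length = l.length := by
  cases l <;> rfl

theorem wordNorm_mapHead_le (φ : B →L[ℂ] B) (l : List B) :
    wordNorm (mapHead φ l) ≤ (1 + ‖φ‖) * wordNorm l := by
  cases l with
  | nil => simp [mapHead]
  | cons x l =>
    rw [mapHead, wordNorm_cons, wordNorm_cons, ← mul_assoc]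
    have := wordNorm_nonneg l
    gcongr
    refine (φ.le_opNorm x).trans ?_
    gcongr
    linarith

/-- The first letter of the word, if any, lies in the kernel of `π`. -/
def HeadInKer {A : Type*} [Zero A] (π : B → A) : List B → Prop
  | [] => True
  | x :: _ => π x = 0

end Block

/-! ### Primitives with the outer letters as parameters -/

section BlockPrimitive

variable {A : Type u} [NonUnitalNormedRing A] [NormedSpace ℂ A] [SMulCommClass ℂ A A]
  [IsScalarTower ℂ A A]
variable {B : Type*} [NormedAddCommGroup B] [NormedSpace ℂ B]

/-- The function of words in `A` obtained by inserting them between two words in `B`. -/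
def insertFun (ι : A → B) (g : List B → ℂ) (y x : List B) (w : List A) : ℂ :=
  g (y ++ (w.map ι ++ x))

theorem isMultilinearOn_insertFun (ι : A →L[ℂ] B) {g : List B → ℂ} {r k q : ℕ}
    (hg : IsMultilinearOn (r + (k + q)) g) {y x : List B} (hy : y.length = r)
    (hx : x.length = q) : IsMultilinearOn k (insertFun ι g y x) := by
  refine .of_lin (fun u v c a b h => ?_) ?_
  · have e : ∀ d : A, y ++ ((u ++ d :: v).map ι ++ x) =
        (y ++ u.map ι) ++ ι d :: (v.map ι ++ x) := by simp
    simp only [insertFun, e, map_add, map_smul]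
    exact hg.lin _ _ _ _ _ (by simp; omega)
  · obtain ⟨K, hK, hb⟩ := hg.bound
    refine ⟨K * (wordNorm y * (‖ι‖ ^ k * wordNorm x)), ?_, fun l hl => ?_⟩
    · have := wordNorm_nonneg y
      have := wordNorm_nonneg x
      positivity
    · refine (hb _ (by simp; omega)).trans ?_
      have h1 := wordNorm_map_le ι l
      have := wordNorm_nonneg y
      have := wordNorm_nonneg x
      rw [hl] at h1
      rw [wordNorm_append, wordNorm_append]
      calc K * (wordNorm y * (wordNorm (l.map ι) * wordNorm x))
          ≤ K * (wordNorm y * ((‖ι‖ ^ k * wordNorm l) * wordNorm x)) := by gcongr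
        _ = _ := by ring

theorem norm_cochainOf_insertFun_le (ι : A →L[ℂ] B) {g : List B → ℂ} {r k q : ℕ}
    (hg : IsMultilinearOn (r + (k + q)) g) : ∃ K, 0 ≤ K ∧ ∀ y x : List B, y.length = r →
      x.length = q → ‖cochainOf k (insertFun ι g y x)‖ ≤ K * (wordNorm y * wordNorm x) := by
  obtain ⟨K, hK, hb⟩ := hg.bound
  refine ⟨K * ‖ι‖ ^ k, by positivity, fun y x hy hx => ?_⟩
  have := wordNorm_nonneg y
  have := wordNorm_nonneg x
  refine norm_cochainOf_le (isMultilinearOn_insertFun ι hg hy hx) (by positivity) fun l hl => ?_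
  refine (hb _ (by simp; omega)).trans ?_
  have h1 := wordNorm_map_le ι l
  rw [hl] at h1
  rw [wordNorm_append, wordNorm_append]
  calc K * (wordNorm y * (wordNorm (l.map ι) * wordNorm x))
      ≤ K * (wordNorm y * ((‖ι‖ ^ k * wordNorm l) * wordNorm x)) := by gcongr
    _ = _ := by ring

theorem cochainOf_mem_barCocycles {n : ℕ} {f : List A → ℂ} (hf : IsMultilinearOn (n + 1) f)
    (h : ∀ w : List A, w.length = n + 2 → bar f w = 0) : cochainOf (n + 1) f ∈ barCocycles A n := by
  intro a
  simp only [cochainOf_apply hf]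
  rw [← bar_ofFn]
  exact h _ (by simp)

theorem cochainOf_lin {n : ℕ} {f f₁ f₂ : List A → ℂ} (hf : IsMultilinearOn n f)
    (hf₁ : IsMultilinearOn n f₁) (hf₂ : IsMultilinearOn n f₂) (c : ℂ)
    (h : ∀ w : List A, w.length = n → f w = c * f₁ w + f₂ w) :
    cochainOf n f = c • cochainOf n f₁ + cochainOf n f₂ := by
  ext v
  simp only [add_apply, smul_apply, cochainOf_apply hf,
    cochainOf_apply hf₁, cochainOf_apply hf₂, smul_eq_mul]
  exact h _ (by simp)

variable {ι : A →L[ℂ] B} {π : B →L[ℂ] A}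

/-- The projection onto the kernel of `π` along the range of `ι`. -/
def kerProj (ι : A →L[ℂ] B) (π : B →L[ℂ] A) : B →L[ℂ] B :=
  ContinuousLinearMap.id ℂ B - ι.comp π

theorem kerProj_apply (b : B) : kerProj ι π b = b - ι (π b) := rfl

theorem map_kerProj (hπ : ∀ a, π (ι a) = a) (b : B) : π (kerProj ι π b) = 0 := by
  rw [kerProj_apply, map_sub, hπ, sub_self]

theorem kerProj_ι (hπ : ∀ a, π (ι a) = a) (a : A) : kerProj ι π (ι a) = 0 := by
  rw [kerProj_apply, hπ, sub_self]

theorem kerProj_of_ker {b : B} (hb : π b = 0) : kerProj ι π b = b := by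
  rw [kerProj_apply, hb, map_zero, sub_zero]

theorem headInKer_mapHead_kerProj (hπ : ∀ a, π (ι a) = a) (x : List B) :
    HeadInKer π (mapHead (kerProj ι π) x) := by
  cases x with
  | nil => trivial
  | cons b x => exact map_kerProj hπ b

theorem mapHead_kerProj {x : List B} (hx : HeadInKer π x) : mapHead (kerProj ι π) x = x := by
  cases x with
  | nil => rfl
  | cons b x => rw [mapHead, kerProj_of_ker hx]

theorem map_kerProj_eq {y : List B} (hy : ∀ b ∈ y, π b = 0) : y.map (kerProj ι π) = y :=
  (List.map_congr_left fun b hb => kerProj_of_ker (hy b hb)).trans (List.map_id' y)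

/-- For fixed outer words y and x the bar section gives a primitive of the function of the middle
block, and its linearity keeps the result multilinear in y and x. To define h on all words, the
letters of y and the first letter of x are projected to ker π and the block letters to A. These
projections force the three vanishing clauses: the first two protect the lower types, the third
makes h vanish on words in ker π. The tail of x stays arbitrary, since a letter of A there does not
lower the type. -/
theorem exists_block_primitive (hA : StronglyHUnital A) (hπ : ∀ a, π (ι a) = a) {r k q : ℕ}
    {g : List B → ℂ} (hg : IsMultilinearOn (r + (k + 2 + q)) g)
    (hcyc : ∀ y x : List B, y.length = r → (∀ b ∈ y, π b = 0) → x.length = q →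
      HeadInKer π x → ∀ w : List A, w.length = k + 3 → bar (insertFun ι g y x) w = 0) :
    ∃ h : List B → ℂ, IsMultilinearOn (r + (k + 1 + q)) h ∧
      (∀ y x : List B, y.length = r → (∀ b ∈ y, π b = 0) → x.length = q → HeadInKer π x →
        ∀ w : List A, w.length = k + 2 → bar (insertFun ι h y x) w = insertFun ι g y x w) ∧
      (∀ (u v : List B) (a : A), u.length < r → u.length + v.length = r + k + q →
        h (u ++ ι a :: v) = 0) ∧
      (∀ (u v : List B) (a : A), v.length + 1 = q → u.length + v.length = r + k + q →
        h (u ++ ι a :: v) = 0) ∧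
      (∀ (u v : List B) (b : B), π b = 0 → r ≤ u.length → u.length ≤ r + k →
        u.length + v.length = r + k + q → h (u ++ b :: v) = 0) := by
  obtain ⟨s, K, hK, hs⟩ := exists_bar_section hA k
  let P := kerProj ι π
  let G : List B → List B → Cochains A (k + 1) := fun y x =>
    cochainOf (k + 2) (insertFun ι g (y.map P) (mapHead P x))
  have hF : ∀ y x : List B, y.length = r → x.length = q →
      IsMultilinearOn (k + 2) (insertFun ι g (y.map P) (mapHead P x)) := fun y x hy hx =>
    isMultilinearOn_insertFun ι hg (by simpa using hy) (by simpa using hx)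
  -- The projections put arbitrary outer words into the range of `hcyc`; so s is only ever used on
  -- cocycles, where it is bounded.
  have hG : ∀ y x : List B, y.length = r → x.length = q → G y x ∈ barCocycles A (k + 1) :=
    fun y x hy hx => cochainOf_mem_barCocycles (hF y x hy hx) fun w hw =>
      hcyc _ _ (by simpa using hy) (by
        intro b hb
        obtain ⟨c, -, rfl⟩ := List.mem_map.1 hb
        exact map_kerProj hπ c) (by simpa using hx) (headInKer_mapHead_kerProj hπ x) w hw
  let H : List B → List B → List B → ℂ := fun y w x => wordFun (s (G y x)) (w.map π)
  have hwy : ∀ u v (c : ℂ) a b x, u.length + v.length + 1 = r → x.length = q →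
      G (u ++ (c • a + b) :: v) x = c • G (u ++ a :: v) x + G (u ++ b :: v) x := by
    intro u v c a b x h hx
    refine cochainOf_lin (hF _ _ (by simp; omega) hx) (hF _ _ (by simp; omega) hx)
      (hF _ _ (by simp; omega) hx) c fun w hw => ?_
    have e : ∀ d : B, (u ++ d :: v).map P ++ (w.map ι ++ mapHead P x) =
        u.map P ++ P d :: (v.map P ++ (w.map ι ++ mapHead P x)) := by simp
    simp only [insertFun, e, map_add, map_smul]
    exact hg.lin _ _ _ _ _ (by simp; omega)
  have hwx : ∀ u v (c : ℂ) a b y, u.length + v.length + 1 = q → y.length = r →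
      G y (u ++ (c • a + b) :: v) = c • G y (u ++ a :: v) + G y (u ++ b :: v) := by
    intro u v c a b y h hy
    refine cochainOf_lin (hF _ _ hy (by simp; omega)) (hF _ _ hy (by simp; omega))
      (hF _ _ hy (by simp; omega)) c fun w hw => ?_
    cases u with
    | nil =>
      have e : ∀ d : B, y.map P ++ (w.map ι ++ mapHead P ([] ++ d :: v)) =
        (y.map P ++ w.map ι) ++ P d :: v := by simp [mapHead]
      simp only [insertFun, e, map_add, map_smul]
      exact hg.lin _ _ _ _ _ (by simp at h ⊢; omega)
    | cons u₀ u =>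
      have e : ∀ d : B, y.map P ++ (w.map ι ++ mapHead P (u₀ :: u ++ d :: v)) =
        (y.map P ++ (w.map ι ++ P u₀ :: u)) ++ d :: v := by simp [mapHead]
      simp only [insertFun, e]
      exact hg.lin _ _ _ _ _ (by simp at h ⊢; omega)
  have hlin : ∀ (c : ℂ) (z z' : Cochains A k) (w : List A),
      wordFun (c • z + z') w = c * wordFun z w + wordFun z' w := fun c z z' w => rfl
  have hml : IsMultilinearOn (r + (k + 1 + q)) (blockFun r (k + 1) H) := by
    refine isMultilinearOn_blockFun ?_ ?_ ?_ ?_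
    · intro u v c a b w x h hw hx
      simp only [H]
      rw [hwy u v c a b x h hx, map_add, map_smul, hlin]
    · intro u v c a b y x h hy hx
      have e : ∀ d : B, (u ++ d :: v).map π = u.map π ++ π d :: v.map π := by simp
      simp only [H, e, map_add, map_smul]
      exact (isMultilinearOn_wordFun _).lin _ _ _ _ _ (by simpa using h)
    · intro u v c a b y w h hy hw
      simp only [H]
      rw [hwx u v c a b y h hy, map_add, map_smul, hlin]
    · obtain ⟨K', hK', hb⟩ := norm_cochainOf_insertFun_le ι hg
      refine ⟨K * (K' * (‖P‖ ^ r * (1 + ‖P‖))) * ‖π‖ ^ (k + 1), by positivity,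
        fun y w x hy hw hx => ?_⟩
      have h1 : ‖G y x‖ ≤ K' * ((‖P‖ ^ r * wordNorm y) * ((1 + ‖P‖) * wordNorm x)) := by
        refine (hb _ _ (by simpa using hy) (by simpa using hx)).trans ?_
        have h2 := wordNorm_map_le P y
        rw [hy] at h2
        have := wordNorm_nonneg y
        gcongr
        · exact wordNorm_nonneg _
        · exact wordNorm_mapHead_le P x
      have h3 := wordNorm_map_le π w
      rw [hw] at h3
      have := wordNorm_nonneg y
      have := wordNorm_nonneg x
      have := wordNorm_nonneg w
      calc ‖H y w x‖ ≤ ‖s (G y x)‖ * wordNorm (w.map π) :=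
            norm_wordFun_le _ (by simpa using hw)
        _ ≤ (K * (K' * ((‖P‖ ^ r * wordNorm y) * ((1 + ‖P‖) * wordNorm x)))) *
            (‖π‖ ^ (k + 1) * wordNorm w) := by
          have h4 := (hs _ (hG y x hy hx)).1
          have h5 : ‖s (G y x)‖ ≤
              K * (K' * ((‖P‖ ^ r * wordNorm y) * ((1 + ‖P‖) * wordNorm x))) :=
            h4.trans (by gcongr)
          gcongr
          exact wordNorm_nonneg _
        _ = _ := by ring
  refine ⟨blockFun r (k + 1) H, hml, ?_, ?_, ?_, ?_⟩
  · intro y x hy hyC hx hxC w hw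
    have h1 : bar (insertFun ι (blockFun r (k + 1) H) y x) w = bar (wordFun (s (G y x))) w := by
      refine bar_congr fun m hm => ?_
      rw [insertFun, blockFun_append H x hy (by simp; omega)]
      simp only [H, List.map_map]
      congr 1
      exact (List.map_congr_left fun a _ => hπ a).trans (List.map_id' m)
    -- On admissible outer words the projections do nothing.
    have h2 : G y x = cochainOf (k + 2) (insertFun ι g y x) := by
      simp only [G, P]
      rw [map_kerProj_eq hyC, mapHead_kerProj hxC]
    have hI := isMultilinearOn_insertFun ι hg hy hx
    rw [h1, eq_ofFn_getD hw, bar_ofFn]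
    simp only [wordFun_ofFn]
    rw [(hs _ (hG y x hy hx)).2, h2, cochainOf_apply hI]
  · intro u v a hu h
    obtain ⟨v₁, v', rfl, hv₁, hv'⟩ := exists_eq_append
      (show v.length = (r - u.length - 1) + (k + 1 + q) by omega)
    obtain ⟨w, x, rfl, hw, hx⟩ := exists_eq_append hv'
    have e : u ++ ι a :: (v₁ ++ (w ++ x)) = (u ++ ι a :: v₁) ++ (w ++ x) := by simp
    rw [e, blockFun_append H x (by simp; omega) hw]
    have h0 : G (u ++ ι a :: v₁) x = 0 := by
      ext v
      have e : (u ++ ι a :: v₁).map P = u.map P ++ 0 :: v₁.map P := by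
        simp [P, kerProj_ι hπ]
      simp only [G]
      rw [cochainOf_apply (hF _ _ (by simp; omega) hx), insertFun, e, List.append_assoc,
        List.cons_append, hg.map_zero (by simp; omega)]
      rfl
    simp only [H, h0, map_zero]
    rfl
  · intro u v a hv h
    obtain ⟨y, w, rfl, hy, hw⟩ := exists_eq_append (show u.length = r + (k + 1) by omega)
    rw [List.append_assoc, blockFun_append H _ hy hw]
    have h0 : G y (ι a :: v) = 0 := by
      ext z
      simp only [G]
      rw [cochainOf_apply (hF _ _ hy (by simpa using hv)), insertFun, mapHead, kerProj_ι hπ,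
        ← List.append_assoc, hg.map_zero (by simp; omega)]
      rfl
    simp only [H, h0, map_zero]
    rfl
  · intro u v b hb h1 h2 h
    obtain ⟨y, w₁, rfl, hy, hw₁⟩ := exists_eq_append
      (show u.length = r + (u.length - r) by omega)
    obtain ⟨w₂, x, rfl, hw₂, hx⟩ := exists_eq_append
      (show v.length = (r + k - (y ++ w₁).length) + q by omega)
    have e : y ++ w₁ ++ b :: (w₂ ++ x) = y ++ ((w₁ ++ b :: w₂) ++ x) := by simp
    have hl : y.length + w₁.length = (y ++ w₁).length := by simp
    rw [e, blockFun_append H x hy (by simp; omega)]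
    have e' : (w₁ ++ b :: w₂).map π = w₁.map π ++ 0 :: w₂.map π := by simp [hb]
    simp only [H, e']
    exact (isMultilinearOn_wordFun _).map_zero (by simp; omega)

end BlockPrimitive

/-! ### Extension of cocycles from an ideal -/

theorem bar_eq_zero_of_forall_mem {B : Type*} [Mul B] {p : B → Prop}
    (hp : ∀ x y, p x → p y → p (x * y)) {f : List B → ℂ} {l : List B} (hl : ∀ b ∈ l, p b)
    (h : ∀ m : List B, m.length + 1 = l.length → (∀ b ∈ m, p b) → f m = 0) : bar f l = 0 := by
  induction l generalizing f with
  | nil => simp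
  | cons x l ih =>
    cases l with
    | nil => simp
    | cons y l =>
      simp only [List.mem_cons, forall_eq_or_imp] at hl
      rw [bar_cons_cons, h _ (by simp) (by simpa using ⟨hp _ _ hl.1 hl.2.1, hl.2.2⟩),
        ih (by simpa using hl.2) fun m hm hpm => h _ (by simpa using hm)
          (by simpa using ⟨hl.1, hpm⟩), sub_zero]

theorem hoch_eq_zero_of_forall_mem {B : Type*} [Mul B] {p : B → Prop}
    (hp : ∀ x y, p x → p y → p (x * y)) {f : List B → ℂ} {l : List B} (hl2 : 2 ≤ l.length)
    (hl : ∀ b ∈ l, p b)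
    (h : ∀ m : List B, m.length + 1 = l.length → (∀ b ∈ m, p b) → f m = 0) : hoch f l = 0 := by
  rw [hoch, bar_eq_zero_of_forall_mem hp hl h, h _ (length_rot hl2), mul_zero, add_zero]
  obtain ⟨x, m, z, rfl⟩ := exists_eq_cons_append hl2
  rw [rot_cons_append]
  simp only [List.mem_cons, List.mem_append, List.not_mem_nil, or_false] at hl ⊢
  rintro b (rfl | hb)
  · exact hp _ _ (hl _ (by simp)) (hl _ (by simp))
  · exact hl _ (by simp [hb])

/-! ### Types of words relative to a split ideal -/

section SplitIdeal

variable {A : Type u} [NonUnitalNormedRing A] [NormedSpace ℂ A] [SMulCommClass ℂ A A]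
  [IsScalarTower ℂ A A]
variable {B : Type*} [NormedAddCommGroup B] [NormedSpace ℂ B] [Mul B]

/-- `A` is, via `ι`, a closed ideal of `B`, complemented by the subalgebra `ker π`. -/
structure IsSplitIdeal (ι : A →L[ℂ] B) (π : B →L[ℂ] A) : Prop extends IsBanachMul B where
  map_ι : ∀ a, π (ι a) = a
  ι_mul : ∀ a b, ι (a * b) = ι a * ι b
  mul_mem : ∀ b a, ∃ a', b * ι a = ι a'
  mem_mul : ∀ a b, ∃ a', ι a * b = ι a'
  ker_mul : ∀ x y, π x = 0 → π y = 0 → π (x * y) = 0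

/-- `f` vanishes on the words of length `N` that consist of `r` letters in `ker π`, some letters
of `A`, and `q` arbitrary letters. -/
def Vanishes (ι : A → B) (π : B → A) (N r q : ℕ) (f : List B → ℂ) : Prop :=
  ∀ (y : List B) (w : List A) (x : List B), y.length = r → (∀ b ∈ y, π b = 0) → w ≠ [] →
    x.length = q → r + (w.length + q) = N → f (y ++ (w.map ι ++ x)) = 0

/-- `f` satisfies `Vanishes` for all indices that are lexicographically below `(r, q)`. -/
def VanishesBelow (ι : A → B) (π : B → A) (N r q : ℕ) (f : List B → ℂ) : Prop :=
  (∀ r' < r, ∀ q', Vanishes ι π N r' q' f) ∧ ∀ q' < q, Vanishes ι π N r q' f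

theorem VanishesBelow.mono_left {ι : A → B} {π : B → A} {N r q r' : ℕ} {f : List B → ℂ}
    (h : VanishesBelow ι π N r q f) (hr : r' < r) (q' : ℕ) : VanishesBelow ι π N r' q' f :=
  ⟨fun r'' hr'' q'' => h.1 r'' (hr''.trans hr) q'', fun q'' _ => h.1 r' hr q''⟩

theorem VanishesBelow.mono_right {ι : A → B} {π : B → A} {N r q q' : ℕ} {f : List B → ℂ}
    (h : VanishesBelow ι π N r q f) (hq : q' ≤ q) : VanishesBelow ι π N r q' f :=
  ⟨h.1, fun q'' hq'' => h.2 q'' (hq''.trans_le hq)⟩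

/-! ### The differential on the lowest surviving type -/

variable {ι : A →L[ℂ] B} {π : B →L[ℂ] A}

/-- Faces inside y stay in ker π, and the face joining y to the block is absorbed by the ideal. Both
leave a shorter prefix with a block of the same length, where f vanishes. Passing each letter of y
contributes a sign. -/
theorem bar_append_left (hι : IsSplitIdeal ι π) {f : List B → ℂ} {y x : List B} {w : List A}
    (hw : w ≠ []) (hy : ∀ b ∈ y, π b = 0)
    (h : ∀ (y' : List B) (w' : List A), y'.length + 1 = y.length → (∀ b ∈ y', π b = 0) →
      w'.length = w.length → f (y' ++ (w'.map ι ++ x)) = 0) :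
    bar f (y ++ (w.map ι ++ x)) =
      (-1) ^ y.length * bar (fun l => f (y ++ l)) (w.map ι ++ x) := by
  induction y generalizing f with
  | nil => simp
  | cons c y ih =>
    have h1 := ih (f := fun l => f (c :: l)) (fun b hb => hy b (by simp [hb]))
      fun y' w' hy' hyk hw' => h (c :: y') w' (by simpa using hy')
        (by simpa using ⟨hy c (by simp), hyk⟩) hw'
    have h2 : bar f (c :: y ++ (w.map ι ++ x)) =
        - bar (fun l => f (c :: l)) (y ++ (w.map ι ++ x)) := by
      cases y with
      | nil =>
        obtain ⟨a, w, rfl⟩ := List.exists_cons_of_ne_nil hw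
        obtain ⟨a', ha'⟩ := hι.mul_mem c a
        simp only [List.cons_append, List.nil_append, List.map_cons, bar_cons_cons, ha']
        have := h [] (a' :: w) (by simp) (by simp) (by simp)
        simp only [List.nil_append, List.map_cons, List.cons_append] at this
        rw [this, zero_sub]
      | cons d y =>
        simp only [List.cons_append, bar_cons_cons]
        have := h (c * d :: y) w (by simp) (by
          simp only [List.mem_cons, forall_eq_or_imp] at hy ⊢
          exact ⟨hι.ker_mul _ _ hy.1 hy.2.1, hy.2.2⟩) rfl
        simp only [List.cons_append] at this
        rw [this, zero_sub]
    rw [h2, h1, List.length_cons, pow_succ]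
    simp

/-- The face joining the block to x is absorbed into A, and faces inside x shorten x; f vanishes on
all of these. -/
theorem bar_append_right (hι : IsSplitIdeal ι π) {f : List B → ℂ} {x : List B} {w : List A}
    (hw : w ≠ [])
    (h : ∀ (w' : List A) (x' : List B), w'.length = w.length → x'.length + 1 = x.length →
      f (w'.map ι ++ x') = 0) :
    bar f (w.map ι ++ x) = bar (fun m => f (m.map ι ++ x)) w := by
  induction w generalizing f with
  | nil => exact absurd rfl hw
  | cons a w ih =>
    cases w with
    | nil =>
      rw [bar_singleton]
      cases x with
      | nil => simp
      | cons z x =>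
        obtain ⟨a', ha'⟩ := hι.mem_mul a z
        simp only [List.map_cons, List.map_nil, List.cons_append, List.nil_append, bar_cons_cons,
          ha']
        have h1 := h [a'] x (by simp) (by simp)
        simp only [List.map_cons, List.map_nil, List.cons_append, List.nil_append] at h1
        have h2 : bar (fun m => f (ι a :: m)) (z :: x) = 0 :=
          bar_eq_zero fun m hm => h [a] m (by simp) (by simpa using hm)
        rw [h1, h2, sub_zero]
    | cons a' w =>
      have h1 := ih (f := fun l => f (ι a :: l)) (by simp) fun w' x' hw' hx' =>
        h (a :: w') x' (by simpa using hw') hx'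
      simp only [List.map_cons, List.cons_append] at h1 ⊢
      rw [bar_cons_cons, bar_cons_cons, h1, ← hι.ι_mul]
      rfl

/-- Only the faces within the block of letters of `A` contribute to the differential on words
for which all the lower types of words are killed. -/
theorem hoch_eq_bar_insertFun (hι : IsSplitIdeal ι π) {f : List B → ℂ} {M r q : ℕ}
    (hf : IsMultilinearOn M f) (hb : VanishesBelow ι π M r q f) (hrq : 0 < r + q)
    {y x : List B} {w : List A} (hy : y.length = r) (hyk : ∀ b ∈ y, π b = 0) (hw : w ≠ [])
    (hx : x.length = q) (hM : r + (w.length + q) = M + 1) :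
    hoch f (y ++ (w.map ι ++ x)) = (-1) ^ r * bar (insertFun ι f y x) w := by
  have hw0 := List.length_pos_iff.2 hw
  have h1 : bar f (y ++ (w.map ι ++ x)) = (-1) ^ r * bar (insertFun ι f y x) w := by
    rw [bar_append_left hι hw hyk, bar_append_right hι hw, hy]
    · rfl
    · intro w' x' hw' hx'
      exact hb.2 x'.length (by omega) y w' x' hy hyk
        (List.length_pos_iff.1 (by omega)) rfl (by omega)
    · intro y' w' hy' hyk' hw'
      exact hb.1 y'.length (by omega) q y' w' x rfl hyk'
        (List.length_pos_iff.1 (by omega)) hx (by omega)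
  have h2 : f (rot (y ++ (w.map ι ++ x))) = 0 := by
    -- For r > 0, a word beginning in A has a type with no kernel prefix, hence a lower one.
    have hA0 : 0 < r → ∀ (a : A) (m : List B), m.length + 1 = M → f (ι a :: m) = 0 :=
      fun hr a m hm => hb.1 0 hr m.length [] [a] m rfl (by simp) (by simp) rfl
        (by simp; omega)
    cases y with
    | nil =>
      obtain ⟨a, w, rfl⟩ := List.exists_cons_of_ne_nil hw
      rcases List.eq_nil_or_concat x with rfl | ⟨x, z, rfl⟩
      · simp at hx hy; omega
      obtain ⟨a', ha'⟩ := hι.mul_mem z a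
      have e : [] ++ ((a :: w).map ι ++ x.concat z) = ι a :: ((w.map ι ++ x) ++ [z]) := by simp
      rw [e, rot_cons_append, ha']
      simp at hx hy hM
      exact hb.2 x.length (by omega) [] (a' :: w) x hy (by simp) (by simp) rfl
        (by simp; omega)
    | cons c y =>
      have hr : 0 < r := by simp at hy; omega
      rcases List.eq_nil_or_concat x with rfl | ⟨x, z, rfl⟩
      · rcases List.eq_nil_or_concat w with rfl | ⟨w, a, rfl⟩
        · exact absurd rfl hw
        obtain ⟨a', ha'⟩ := hι.mem_mul a c
        have e : c :: y ++ ((w.concat a).map ι ++ []) = c :: ((y ++ w.map ι) ++ [ι a]) := by simp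
        rw [e, rot_cons_append, ha']
        simp at hx hy hM
        exact hA0 hr _ _ (by simp; omega)
      · have e : c :: y ++ (w.map ι ++ x.concat z) = c :: ((y ++ (w.map ι ++ x)) ++ [z]) := by simp
        simp at hx hy hM
        -- The cyclic product z * c is split: its A-part gives a word beginning in A, while its ker
        -- π-part keeps r kernel letters and lowers q by one.
        have h3 := hf.add [] (y ++ (w.map ι ++ x)) (ι (π (z * c))) (kerProj ι π (z * c))
          (by simp; omega)
        simp only [List.nil_append] at h3
        rw [e, rot_cons_append, show z * c = ι (π (z * c)) + kerProj ι π (z * c) by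
          rw [kerProj_apply]; abel, h3, hA0 hr _ _ (by simp; omega), zero_add]
        exact hb.2 x.length (by omega) (kerProj ι π (z * c) :: y) w x (by simpa using hy)
          (by
            simp only [List.mem_cons, forall_eq_or_imp] at hyk ⊢
            exact ⟨map_kerProj hι.map_ι _, hyk.2⟩) hw rfl (by omega)
  rw [hoch, h1, h2, mul_zero, add_zero]

theorem hoch_map_eq_zero (hι : IsSplitIdeal ι π) {h : List B → ℂ} {M : ℕ}
    (h0 : Vanishes ι π (M + 1) 0 0 h) : Vanishes ι π (M + 2) 0 0 (hoch h) := by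
  intro y w x hy _ _ hx hl
  rw [List.length_eq_zero_iff] at hy hx
  subst hy hx
  rw [List.nil_append, List.append_nil, hoch_map hι.ι_mul h (by omega)]
  refine hoch_eq_zero (by omega) fun m hm => ?_
  have := h0 [] m [] rfl (by simp) (List.length_pos_iff.1 (by omega)) rfl (by omega)
  simpa using this

/-- On this type the coboundary is computed inside the block, where h vanishes. The all-A type is
separate because its cyclic face stays inside A. -/
theorem vanishes_hoch (hι : IsSplitIdeal ι π) {h : List B → ℂ} {M r q : ℕ}
    (hh : IsMultilinearOn (M + 1) h) (hb : VanishesBelow ι π (M + 1) r q h)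
    (hv : Vanishes ι π (M + 1) r q h) : Vanishes ι π (M + 2) r q (hoch h) := by
  rcases Nat.eq_zero_or_pos (r + q) with h0 | h0
  · obtain ⟨rfl, rfl⟩ : r = 0 ∧ q = 0 := by omega
    exact hoch_map_eq_zero hι hv
  intro y w x hy hyk hw hx hl
  rw [hoch_eq_bar_insertFun hι hh hb h0 hy hyk hw hx hl]
  cases w with
  | nil => simp
  | cons a w =>
    cases w with
    | nil => simp
    | cons a' w =>
      have h1 : bar (insertFun ι h y x) (a :: a' :: w) = 0 := bar_eq_zero fun m hm =>
        hv y m x hy hyk (List.length_pos_iff.1 (by simp at hm; omega)) hx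
          (by simp at hm hl; omega)
      rw [h1, mul_zero]

theorem vanishesBelow_hoch (hι : IsSplitIdeal ι π) {h : List B → ℂ} {M r q : ℕ}
    (hh : IsMultilinearOn (M + 1) h) (hb : VanishesBelow ι π (M + 1) r q h) :
    VanishesBelow ι π (M + 2) r q (hoch h) :=
  ⟨fun r' hr q' => vanishes_hoch hι hh (hb.mono_left hr q') (hb.1 r' hr q'),
    fun q' hq => vanishes_hoch hι hh (hb.mono_right hq.le) (hb.2 q' hq)⟩

/-- Bounded multilinear functions on words of length `n` that vanish on words in `ker π`. -/
structure IsRelative (π : B → A) (n : ℕ) (f : List B → ℂ) : Prop where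
  multilinear : IsMultilinearOn n f
  ker : ∀ l : List B, l.length = n → (∀ b ∈ l, π b = 0) → f l = 0

theorem IsRelative.hoch (hι : IsSplitIdeal ι π) {n : ℕ} {f : List B → ℂ}
    (hf : IsRelative π (n + 1) f) : IsRelative π (n + 2) (hoch f) where
  multilinear := hf.multilinear.hoch hι.toIsBanachMul
  ker l hl hk := hoch_eq_zero_of_forall_mem (p := fun b => π b = 0) hι.ker_mul (by omega) hk
    fun m hm hmk => hf.ker m (by omega) hmk

theorem IsRelative.sub {n : ℕ} {f g : List B → ℂ} (hf : IsRelative π n f)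
    (hg : IsRelative π n g) : IsRelative π n fun l => f l - g l where
  multilinear := hf.multilinear.sub_fun hg.multilinear
  ker l hl hk := by rw [hf.ker l hl hk, hg.ker l hl hk, sub_zero]

theorem IsRelative.add {n : ℕ} {f g : List B → ℂ} (hf : IsRelative π n f)
    (hg : IsRelative π n g) : IsRelative π n fun l => f l + g l where
  multilinear := hf.multilinear.add_fun hg.multilinear
  ker l hl hk := by rw [hf.ker l hl hk, hg.ker l hl hk, add_zero]

theorem isRelative_zero {n : ℕ} : IsRelative π n fun _ => (0 : ℂ) where
  multilinear := .zero_fun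
  ker _ _ _ := rfl

theorem Vanishes.sub {N r q : ℕ} {f g : List B → ℂ} (hf : Vanishes ι π N r q f)
    (hg : Vanishes ι π N r q g) : Vanishes ι π N r q fun l => f l - g l :=
  fun y w x h1 h2 h3 h4 h5 => by
    beta_reduce
    rw [hf y w x h1 h2 h3 h4 h5, hg y w x h1 h2 h3 h4 h5, sub_zero]

/-- A closed function that vanishes on all lower types of words vanishes on words whose block of
letters of `A` has length one. -/
theorem vanishes_of_block_one (hA : StronglyHUnital A) (hι : IsSplitIdeal ι π) {f : List B → ℂ}
    {r q : ℕ} (hf : IsMultilinearOn (r + (1 + q)) f)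
    (hcyc : ∀ l : List B, l.length = r + (1 + q) + 1 → hoch f l = 0) (hrq : 0 < r + q)
    (hb : VanishesBelow ι π (r + (1 + q)) r q f) : Vanishes ι π (r + (1 + q)) r q f := by
  intro y w x hy hyk hw hx hl
  have hI := isMultilinearOn_insertFun ι hf hy hx
  have hmem : cochainOf 1 (insertFun ι f y x) ∈ barCocycles A 0 :=
    cochainOf_mem_barCocycles hI fun w hw => by
      have h1 := hoch_eq_bar_insertFun hι hf hb hrq hy hyk (w := w)
        (List.length_pos_iff.1 (by omega)) hx (by omega)
      rw [hcyc _ (by simp; omega)] at h1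
      exact (mul_eq_zero.1 h1.symm).resolve_left (pow_ne_zero _ (by norm_num))
  have h0 := eq_zero_of_mem_barCocycles_zero hA _ hmem
  have := wordFun_cochainOf hI (l := w) (by omega)
  rw [h0] at this
  exact this.symm

/-- Killing a closed function on one more type of words. -/
theorem exists_vanishesBelow_succ (hA : StronglyHUnital A) (hι : IsSplitIdeal ι π) {n r q : ℕ}
    {f : List B → ℂ} (hf : IsRelative π (n + 2) f)
    (hcyc : ∀ l : List B, l.length = n + 3 → hoch f l = 0)
    (h0 : Vanishes ι π (n + 2) 0 0 f) (hb : VanishesBelow ι π (n + 2) r q f) :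
    ∃ h : List B → ℂ, IsRelative π (n + 1) h ∧ Vanishes ι π (n + 1) 0 0 h ∧
      VanishesBelow ι π (n + 2) r (q + 1) fun l => f l - hoch h l := by
  -- If the type is already dead, h = 0 works.
  have trivial_case : Vanishes ι π (n + 2) r q f → ∃ h : List B → ℂ,
      IsRelative π (n + 1) h ∧ Vanishes ι π (n + 1) 0 0 h ∧
      VanishesBelow ι π (n + 2) r (q + 1) fun l => f l - hoch h l := by
    intro hv
    refine ⟨fun _ => 0, isRelative_zero, fun _ _ _ _ _ _ _ _ => rfl, ?_⟩
    have e : (fun l => f l - hoch (fun _ : List B => (0 : ℂ)) l) = f := by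
      funext l
      rw [hoch, bar_eq_zero fun _ _ => rfl]
      simp
    rw [e]
    refine ⟨hb.1, fun q' hq' => ?_⟩
    rcases Nat.lt_succ_iff_lt_or_eq.1 hq' with h | rfl
    · exact hb.2 q' h
    · exact hv
  rcases Nat.eq_zero_or_pos (r + q) with hrq | hrq
  · obtain ⟨rfl, rfl⟩ : r = 0 ∧ q = 0 := by omega
    exact trivial_case h0
  rcases lt_trichotomy (r + q) (n + 1) with hlt | heq | hgt
  · obtain ⟨k, hk⟩ : ∃ k, n = r + k + q := ⟨n - r - q, by omega⟩
    have e2 : n + 2 = r + (k + 2 + q) := by omega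
    have e1 : n + 1 = r + (k + 1 + q) := by omega
    obtain ⟨h, hml, hprim, hv1, hv2, hv3⟩ := exists_block_primitive (k := k) (r := r) (q := q)
      -- The factor compensates the sign (-1)^r that the coboundary of h acquires from the prefix.
      (g := fun l => (-1) ^ r * f l) hA hι.map_ι
      (by rw [← e2]; exact hf.multilinear.const_mul _) (by
        intro y x hy hyk hx hxk w hw
        have h1 := hoch_eq_bar_insertFun hι hf.multilinear hb hrq hy hyk (w := w)
          (List.length_pos_iff.1 (by omega)) hx (by omega)
        rw [hcyc _ (by simp; omega)] at h1
        have h2 := (mul_eq_zero.1 h1.symm).resolve_left (pow_ne_zero _ (by norm_num))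
        refine (bar_const_mul ((-1) ^ r) (insertFun ι f y x) w).trans ?_
        rw [h2, mul_zero])
    rw [← e1] at hml
    have hhb : VanishesBelow ι π (n + 1) r q h := by
      constructor
      · intro r' hr' q' y w x hy hyk hw hx hl
        obtain ⟨a, w, rfl⟩ := List.exists_cons_of_ne_nil hw
        rw [List.map_cons, List.cons_append]
        simp at hl
        exact hv1 _ _ _ (by omega) (by simp; omega)
      · intro q' hq' y w x hy hyk hw hx hl
        -- For q' < q the block is long enough to reach position r + k + 1, where the construction
        -- of h projects to ker π.
        obtain ⟨w₁, w₂, rfl, hw₁, hw₂⟩ := exists_eq_append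
          (show w.length = (k + 1) + (q - q') by omega)
        obtain ⟨a, w₂, rfl⟩ := List.exists_cons_of_ne_nil
          (List.length_pos_iff.1 (show 0 < w₂.length by omega))
        have e : y ++ ((w₁ ++ a :: w₂).map ι ++ x) =
            (y ++ w₁.map ι) ++ ι a :: (w₂.map ι ++ x) := by simp
        rw [e]
        simp at hw₂
        exact hv2 _ _ _ (by simp; omega) (by simp; omega)
    have hrel : IsRelative π (n + 1) h := by
      refine ⟨hml, fun l hl hk => ?_⟩
      obtain ⟨u, v, rfl, hu, hv⟩ := exists_eq_append (show l.length = r + (k + q + 1) by omega)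
      obtain ⟨b, v, rfl⟩ := List.exists_cons_of_ne_nil
        (List.length_pos_iff.1 (show 0 < v.length by omega))
      simp at hv
      exact hv3 u v b (hk b (by simp)) (by omega) (by omega) (by omega)
    have hlow := vanishesBelow_hoch hι hml hhb
    have hdiff : IsMultilinearOn (n + 2) fun l => f l - hoch h l :=
      hf.multilinear.sub_fun (hml.hoch hι.toIsBanachMul)
    have hlast : ∀ q' < q, Vanishes ι π (n + 2) r q' fun l => f l - hoch h l :=
      fun q' hq' => (hb.2 q' hq').sub (hlow.2 q' hq')
    have hker : ∀ (y : List B) (w : List A) (x : List B), y.length = r → (∀ b ∈ y, π b = 0) →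
        w ≠ [] → x.length = q → HeadInKer π x → r + (w.length + q) = n + 2 →
        f (y ++ (w.map ι ++ x)) - hoch h (y ++ (w.map ι ++ x)) = 0 := by
      intro y w x hy hyk hw hx hxk hl
      rw [hoch_eq_bar_insertFun hι hml hhb hrq hy hyk hw hx hl,
        hprim y x hy hyk hx hxk w (by omega), insertFun, ← mul_assoc, ← mul_pow]
      simp
    refine ⟨h, hrel, ?_, fun r' hr' q' => (hb.1 r' hr' q').sub (hlow.1 r' hr' q'),
      fun q' hq' => ?_⟩
    · rcases Nat.eq_zero_or_pos r with rfl | hr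
      · exact hhb.2 0 (by omega)
      · exact hhb.1 0 hr 0
    rcases Nat.lt_succ_iff_lt_or_eq.1 hq' with hq' | rfl
    · exact hlast q' hq'
    intro y w x hy hyk hw hx hl
    cases x with
    | nil => exact hker y w [] hy hyk hw hx trivial hl
    | cons b x =>
      -- The ker π-part of the letter after the block is handled by the primitive. Its A-part
      -- lengthens the block, giving the already dead type (r, q - 1).
      have h3 := hdiff.add (y ++ w.map ι) x (ι (π b)) (kerProj ι π b) (by simp at hx ⊢; omega)
      rw [show ι (π b) + kerProj ι π b = b by rw [kerProj_apply]; abel] at h3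
      rw [List.append_assoc, List.append_assoc, List.append_assoc] at h3
      beta_reduce
      rw [h3, hker y w (kerProj ι π b :: x) hy hyk hw hx (map_kerProj hι.map_ι b) hl, add_zero]
      simp at hx
      have := hlast x.length (by omega) y (w ++ [π b]) x hy hyk (by simp) rfl (by simp; omega)
      simpa using this
  -- With a one-letter block there is no lower-degree primitive to choose; vanishing on products
  -- suffices.
  · have e : n + 2 = r + (1 + q) := by omega
    refine trivial_case ?_
    rw [e] at hb ⊢
    exact vanishes_of_block_one hA hι (e ▸ hf.multilinear)
      (fun l hl => hcyc l (by omega)) hrq hb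
  · exact trivial_case fun y w x _ _ hw _ hl => absurd (List.length_pos_iff.2 hw) (by omega)

/-- Corrections are added along the lexicographic order. Each keeps the difference a relative
cocycle vanishing on words in A, so the one-type step applies again. -/
theorem exists_vanishesBelow (hA : StronglyHUnital A) (hι : IsSplitIdeal ι π) {n : ℕ}
    {g : List B → ℂ} (hg : IsRelative π (n + 2) g)
    (hcyc : ∀ l : List B, l.length = n + 3 → hoch g l = 0)
    (h0 : Vanishes ι π (n + 2) 0 0 g) (r : ℕ) :
    ∃ h : List B → ℂ, IsRelative π (n + 1) h ∧ Vanishes ι π (n + 1) 0 0 h ∧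
      VanishesBelow ι π (n + 2) r 0 fun l => g l - hoch h l := by
  have step : ∀ r q, (∃ h : List B → ℂ, IsRelative π (n + 1) h ∧ Vanishes ι π (n + 1) 0 0 h ∧
      VanishesBelow ι π (n + 2) r q fun l => g l - hoch h l) →
      ∃ h : List B → ℂ, IsRelative π (n + 1) h ∧ Vanishes ι π (n + 1) 0 0 h ∧
      VanishesBelow ι π (n + 2) r (q + 1) fun l => g l - hoch h l := by
    rintro r q ⟨h, hh, hh0, hb⟩
    obtain ⟨h', hh', hh0', hb'⟩ := exists_vanishesBelow_succ hA hι (hg.sub (hh.hoch hι))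
      (fun l hl => by rw [hoch_sub, hcyc l hl, hoch_hoch hι.assoc h (by omega), sub_zero])
      (h0.sub (hoch_map_eq_zero hι hh0)) hb
    refine ⟨fun l => h l + h' l, hh.add hh', fun y w x h1 h2 h3 h4 h5 => ?_, ?_⟩
    · beta_reduce
      rw [hh0 y w x h1 h2 h3 h4 h5, hh0' y w x h1 h2 h3 h4 h5, add_zero]
    · have e : (fun l => g l - hoch (fun l => h l + h' l) l) =
          fun l => g l - hoch h l - hoch h' l := by
        funext l; rw [hoch_add]; ring
      rw [e]
      exact hb'
  have inner : ∀ r, (∃ h : List B → ℂ, IsRelative π (n + 1) h ∧ Vanishes ι π (n + 1) 0 0 h ∧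
      VanishesBelow ι π (n + 2) r 0 fun l => g l - hoch h l) →
      ∀ q, ∃ h : List B → ℂ, IsRelative π (n + 1) h ∧ Vanishes ι π (n + 1) 0 0 h ∧
      VanishesBelow ι π (n + 2) r q fun l => g l - hoch h l := by
    intro r hr q
    induction q with
    | zero => exact hr
    | succ q ih => exact step r q ih
  induction r with
  | zero =>
    exact ⟨fun _ => 0, isRelative_zero, fun _ _ _ _ _ _ _ _ => rfl,
      fun r' hr' => absurd hr' (by omega), fun q' hq' => absurd hq' (by omega)⟩
  | succ r ih =>
    -- Words have n + 2 letters, so every possible q is below n + 3, and the whole row r is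
    -- finished.
    obtain ⟨h, hh, hh0, hb⟩ := inner r ih (n + 3)
    refine ⟨h, hh, hh0, fun r' hr' q' => ?_, fun q' hq' => absurd hq' (by omega)⟩
    rcases Nat.lt_succ_iff_lt_or_eq.1 hr' with hr' | rfl
    · exact hb.1 r' hr' q'
    · intro y w x h1 h2 h3 h4 h5
      exact hb.2 q' (by omega) y w x h1 h2 h3 h4 h5

/-- The kernel prefix y grows one letter at a time: the A-part of the next letter is a one-letter
block and contributes zero, and its ker π-part joins the prefix. A word wholly in ker π remains, on
which f vanishes. -/
theorem eq_zero_of_vanishesBelow (hι : IsSplitIdeal ι π) {N : ℕ} {f : List B → ℂ}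
    (hf : IsRelative π N f) (hb : VanishesBelow ι π N (N + 1) 0 f) (y x : List B)
    (hy : ∀ b ∈ y, π b = 0) (hl : y.length + x.length = N) : f (y ++ x) = 0 := by
  induction x generalizing y with
  | nil => exact hf.ker _ (by simpa using hl) (by simpa using hy)
  | cons b x ih =>
    have h3 := hf.multilinear.add y x (ι (π b)) (kerProj ι π b) (by simp at hl; omega)
    rw [show ι (π b) + kerProj ι π b = b by rw [kerProj_apply]; abel] at h3
    have h1 := hb.1 y.length (by omega) x.length y [π b] x rfl hy (by simp) rfl
      (by simp at hl ⊢; omega)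
    have h2 := ih (y ++ [kerProj ι π b]) (by
      intro c hc
      rcases List.mem_append.1 hc with hc | hc
      · exact hy c hc
      · rw [List.mem_singleton.1 hc]
        exact map_kerProj hι.map_ι b) (by simp at hl ⊢; omega)
    rw [List.append_assoc] at h2
    rw [h3]
    exact (congrArg₂ (· + ·) h1 h2).trans (add_zero 0)

theorem IsMultilinearOn.comp_map {E F : Type*} [NormedAddCommGroup E] [NormedSpace ℂ E]
    [NormedAddCommGroup F] [NormedSpace ℂ F] {n : ℕ} {f : List F → ℂ}
    (hf : IsMultilinearOn n f) (φ : E →L[ℂ] F) : IsMultilinearOn n fun l => f (l.map φ) := by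
  refine .of_lin (fun u v c a b h => ?_) ?_
  · simp only [List.map_append, List.map_cons, map_add, map_smul]
    exact hf.lin _ _ _ _ _ (by simpa using h)
  · obtain ⟨K, hK, hb⟩ := hf.bound
    refine ⟨K * ‖φ‖ ^ n, by positivity, fun l hl => (hb _ (by simpa using hl)).trans ?_⟩
    rw [mul_assoc, ← hl]
    gcongr
    exact wordNorm_map_le φ l

/-- Bounded Hochschild cocycles extend from a strongly H-unital split ideal. -/
theorem exists_cocycle_extension (hA : StronglyHUnital A) (hι : IsSplitIdeal ι π) {n : ℕ}
    (D : Cochains A n) (hD : IsCocycle D) :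
    ∃ D' : ContinuousMultilinearMap ℂ (fun _ : Fin (n + 1) => B) ℂ,
      IsCocycle D' ∧ ∀ a : Fin (n + 1) → A, D' (fun i => ι (a i)) = D a := by
  have hrestr : ∀ w : List A, (w.map ι).map π = w := fun w => by
    rw [List.map_map]
    exact (List.map_congr_left fun a _ => hι.map_ι a).trans (List.map_id' w)
  -- The crude extension: it restricts to D and vanishes as soon as one letter is in ker π, but is
  -- not yet closed.
  let f : List B → ℂ := fun l => wordFun D (l.map π)
  have hf : IsRelative π (n + 1) f := by
    refine ⟨(isMultilinearOn_wordFun D).comp_map π, fun l hl hk => ?_⟩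
    cases l with
    | nil => simp at hl
    | cons b l =>
      simp only [f, List.map_cons, hk b (by simp)]
      exact (isMultilinearOn_wordFun D).map_zero (x := []) (by simpa using hl)
  have h0 : Vanishes ι π (n + 2) 0 0 (hoch f) := by
    intro y w x hy _ _ hx hl
    rw [List.length_eq_zero_iff] at hy hx
    subst hy hx
    rw [List.nil_append, List.append_nil, hoch_map hι.ι_mul f (by omega)]
    simp only [f, hrestr]
    exact (isCocycle_iff_hoch_wordFun D).1 hD w (by omega)
  -- The coboundary lives on words of n + 2 letters, so the bound n + 3 on the prefix length covers
  -- all types.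
  obtain ⟨h, hh, hh0, hb⟩ := exists_vanishesBelow hA hι (hf.hoch hι)
    (fun l hl => hoch_hoch hι.assoc f (by omega)) h0 (n + 3)
  have hfh : IsMultilinearOn (n + 1) fun l => f l - h l := (hf.sub hh).multilinear
  refine ⟨cochainOf (n + 1) fun l => f l - h l, ?_, fun a => ?_⟩
  · rw [isCocycle_iff_hoch_wordFun]
    intro l hl
    rw [hoch_congr (by omega) fun m hm => wordFun_cochainOf hfh (by omega), hoch_sub]
    exact eq_zero_of_vanishesBelow hι ((hf.hoch hι).sub (hh.hoch hι)) hb [] l (by simp)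
      (by simpa using hl)
  · rw [cochainOf_apply hfh]
    have e : List.ofFn (fun i => ι (a i)) = (List.ofFn a).map ι := by
      rw [List.map_ofFn]; rfl
    have h1 := hh0 [] (List.ofFn a) [] rfl (by simp) (by simp) rfl (by simp)
    rw [List.nil_append, List.append_nil] at h1
    rw [e, h1, sub_zero]
    simp only [f, hrestr, wordFun_ofFn]

end SplitIdeal

/-! ### The semidirect product with an algebra of multipliers -/

section Semidirect

variable {A : Type u} [NonUnitalNormedRing A] [NormedSpace ℂ A] [SMulCommClass ℂ A A]
  [IsScalarTower ℂ A A]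

theorem norm_fst_apply_le (m : 𝓜(ℂ, A)) (a : A) : ‖m.fst a‖ ≤ ‖m‖ * ‖a‖ := by
  refine m.fst.le_of_opNorm_le ?_ a
  exact norm_fst_le m.toProd

theorem continuous_fst_apply (a : A) : Continuous fun m : 𝓜(ℂ, A) => m.fst a := by
  refine AddMonoidHomClass.continuous_of_bound
    ({ toFun := fun m => m.fst a, map_zero' := rfl, map_add' := fun _ _ => rfl } : 𝓜(ℂ, A) →+ A)
    ‖a‖ fun m => ?_
  rw [mul_comm]
  exact norm_fst_apply_le m a

theorem norm_snd_apply_le (m : 𝓜(ℂ, A)) (a : A) : ‖m.snd a‖ ≤ ‖m‖ * ‖a‖ := by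
  refine m.snd.le_of_opNorm_le ?_ a
  exact norm_snd_le m.toProd

theorem continuous_snd_apply (a : A) : Continuous fun m : 𝓜(ℂ, A) => m.snd a := by
  refine AddMonoidHomClass.continuous_of_bound
    ({ toFun := fun m => m.snd a, map_zero' := rfl, map_add' := fun _ _ => rfl } : 𝓜(ℂ, A) →+ A)
    ‖a‖ fun m => ?_
  rw [mul_comm]
  exact norm_snd_apply_le m a

variable (A) in
/-- The algebra of multipliers. -/
def multipliers : Subalgebra ℂ 𝓜(ℂ, A) where
  carrier := {m | IsMultiplier m}
  mul_mem' {m n} hm hn := ⟨fun x y => by simp [hm.1, hn.1], fun x y => by simp [hm.2, hn.2]⟩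
  add_mem' {m n} hm hn := ⟨fun x y => by simp [hm.1, hn.1, add_mul],
    fun x y => by simp [hm.2, hn.2, mul_add]⟩
  algebraMap_mem' c := ⟨fun x y => by simp [Algebra.algebraMap_eq_smul_one, smul_mul_assoc],
    fun x y => by simp [Algebra.algebraMap_eq_smul_one, mul_smul_comm]⟩

/-- Needed because C is a closure: limits of the generators must still satisfy the multiplier
identities. -/
theorem isClosed_multipliers : IsClosed (multipliers A : Set 𝓜(ℂ, A)) := by
  have : (multipliers A : Set 𝓜(ℂ, A)) =
      (⋂ (x : A) (y : A), {m | m.fst (x * y) = m.fst x * y}) ∩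
      ⋂ (x : A) (y : A), {m | m.snd (x * y) = x * m.snd y} := by
    ext m
    simp only [Set.mem_inter_iff, Set.mem_iInter, Set.mem_ofPred_eq]
    rfl
  rw [this]
  refine .inter (isClosed_iInter fun x => isClosed_iInter fun y => ?_)
    (isClosed_iInter fun x => isClosed_iInter fun y => ?_)
  · exact isClosed_eq (continuous_fst_apply _) ((continuous_fst_apply x).mul continuous_const)
  · exact isClosed_eq (continuous_snd_apply _) (continuous_const.mul (continuous_snd_apply y))

theorem matrixMultiplier_mem {S R : 𝓜(ℂ, A)} (hS : IsMultiplier S) (hR : IsMultiplier R)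
    (U : Matrix ℕ ℕ ℂ) : matrixMultiplier S R U ∈ multipliers A := by
  have hS' : S ∈ multipliers A := hS
  have hR' : R ∈ multipliers A := hR
  refine add_mem (one_mem _) (finsum_induction (· ∈ multipliers A) (zero_mem _)
    (fun _ _ => add_mem) fun ij => Subalgebra.smul_mem _ ?_ _)
  exact mul_mem (mul_mem (pow_mem hS' _) (sub_mem (one_mem _) (mul_mem hS' hR'))) (pow_mem hR' _)

theorem signedPermAlgebra_le_multipliers {S R : 𝓜(ℂ, A)} (hS : IsMultiplier S)
    (hR : IsMultiplier R) : signedPermAlgebra S R ≤ multipliers A := by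
  refine Subalgebra.topologicalClosure_minimal (Algebra.adjoin_le ?_) isClosed_multipliers
  rintro _ ⟨U, -, rfl⟩
  exact matrixMultiplier_mem hS hR U

/-- The left and right actions of multipliers on a strongly H-unital algebra commute. -/
theorem snd_fst_apply (hA : StronglyHUnital A) {m n : 𝓜(ℂ, A)} (hm : IsMultiplier m)
    (hn : IsMultiplier n) (a : A) : n.snd (m.fst a) = m.fst (n.snd a) := by
  refine (SeparatingDual.eq_iff_forall_dual_eq (R := ℂ)).2 fun φ => ?_
  let ψ : A →L[ℂ] ℂ := φ.comp (n.snd.comp m.fst - m.fst.comp n.snd)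
  let z : Cochains A 0 := ψ.compContinuousMultilinearMap
    (ContinuousMultilinearMap.ofSubsingleton ℂ A A (0 : Fin 1) (ContinuousLinearMap.id ℂ A))
  have hz : ∀ v : Fin 1 → A, z v = ψ (v 0) := fun v => rfl
  -- On a product, (m(xy))n and m((xy)n) both equal (mx)(yn); thus the commutator composed with φ
  -- kills products.
  have h0 := eq_zero_of_mem_barCocycles_zero hA z fun v => by
    have e : faceTuple (0 : Fin 1) v 0 = v 0 * v 1 := by simp [faceTuple, Fin.contractNth]
    simp [hz, e, ψ, hm.1, hn.2]
  have := hz fun _ => a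
  rw [h0] at this
  have h1 : φ (n.snd (m.fst a) - m.fst (n.snd a)) = 0 := this.symm
  rwa [map_sub, sub_eq_zero] at h1

/-! ### The semidirect product as a split extension of A -/

variable (C : Subalgebra ℂ 𝓜(ℂ, A))

theorem SemidirectSum.fst_mul (x y : SemidirectSum A C) : (x * y).fst =
    x.fst * y.fst + (x.snd : 𝓜(ℂ, A)).fst y.fst + (y.snd : 𝓜(ℂ, A)).snd x.fst := rfl

theorem SemidirectSum.snd_mul (x y : SemidirectSum A C) : (x * y).snd = x.snd * y.snd := rfl

theorem SemidirectSum.ext_parts {x y : SemidirectSum A C} (h₁ : x.fst = y.fst)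
    (h₂ : x.snd = y.snd) : x = y :=
  WithLp.ofLp_injective 1 (Prod.ext h₁ h₂)

theorem SemidirectSum.norm_eq (x : SemidirectSum A C) : ‖x‖ = ‖x.fst‖ + ‖x.snd‖ :=
  WithLp.prod_norm_eq_of_L1 x

variable {C}

/-- Associativity is the substantial law: it combines the multiplier identities, the double
centralizer identity for the middle factor, and `snd_fst_apply` for multipliers on both sides of an
element of A. -/
theorem isBanachMul_semidirectSum (hA : StronglyHUnital A) (hC : C ≤ multipliers A) :
    IsBanachMul (SemidirectSum A C) where
  assoc x y z := by
    refine SemidirectSum.ext_parts C ?_ ?_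
    · have hx : IsMultiplier (x.snd : 𝓜(ℂ, A)) := hC x.snd.2
      have hz : IsMultiplier (z.snd : 𝓜(ℂ, A)) := hC z.snd.2
      have hxz := snd_fst_apply hA hx hz y.fst
      have hy := (y.snd : 𝓜(ℂ, A)).central x.fst z.fst
      simp only [SemidirectSum.fst_mul, SemidirectSum.snd_mul, add_mul, mul_add, map_add,
        MulMemClass.coe_mul, DoubleCentralizer.mul_fst, DoubleCentralizer.mul_snd,
        mul_apply_eq_comp, hx.1, hz.2, hxz, hy, mul_assoc]
      abel
    · simp only [SemidirectSum.snd_mul, mul_assoc]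
  add_mul x y z := by
    refine SemidirectSum.ext_parts C ?_ ?_
    · simp only [SemidirectSum.fst_mul, WithLp.add_fst, WithLp.add_snd, add_mul, map_add,
        AddMemClass.coe_add, DoubleCentralizer.add_fst, add_apply]
      abel
    · simp only [SemidirectSum.snd_mul, WithLp.add_snd, add_mul]
  mul_add x y z := by
    refine SemidirectSum.ext_parts C ?_ ?_
    · simp only [SemidirectSum.fst_mul, WithLp.add_fst, WithLp.add_snd, mul_add, map_add,
        AddMemClass.coe_add, DoubleCentralizer.add_snd, add_apply]
      abel
    · simp only [SemidirectSum.snd_mul, WithLp.add_snd, mul_add]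
  smul_mul c x y := by
    refine SemidirectSum.ext_parts C ?_ ?_
    · simp only [SemidirectSum.fst_mul, WithLp.smul_fst, WithLp.smul_snd, smul_mul_assoc, map_smul,
        Subalgebra.coe_smul, DoubleCentralizer.smul_fst, smul_apply, smul_add]
    · simp only [SemidirectSum.snd_mul, WithLp.smul_snd, smul_mul_assoc]
  mul_smul c x y := by
    refine SemidirectSum.ext_parts C ?_ ?_
    · simp only [SemidirectSum.fst_mul, WithLp.smul_fst, WithLp.smul_snd, mul_smul_comm, map_smul,
        Subalgebra.coe_smul, DoubleCentralizer.smul_snd, smul_apply, smul_add]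
    · simp only [SemidirectSum.snd_mul, WithLp.smul_snd, mul_smul_comm]
  norm_mul_le x y := by
    simp only [SemidirectSum.norm_eq, SemidirectSum.fst_mul, SemidirectSum.snd_mul]
    have h1 := norm_add₃_le (a := x.fst * y.fst) (b := (x.snd : 𝓜(ℂ, A)).fst y.fst)
      (c := (y.snd : 𝓜(ℂ, A)).snd x.fst)
    have h2 := norm_mul_le x.fst y.fst
    have h3 := norm_fst_apply_le (x.snd : 𝓜(ℂ, A)) y.fst
    have h4 := norm_snd_apply_le (y.snd : 𝓜(ℂ, A)) x.fst
    have h5 := norm_mul_le x.snd y.snd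
    have h6 : ‖(x.snd : 𝓜(ℂ, A))‖ = ‖x.snd‖ := rfl
    have h7 : ‖(y.snd : 𝓜(ℂ, A))‖ = ‖y.snd‖ := rfl
    rw [h6] at h3
    rw [h7] at h4
    linarith

variable (C)

/-- The inclusion `A → A ⊕ C` as an operator. -/
def SemidirectSum.inlL : A →L[ℂ] SemidirectSum A C :=
  (WithLp.prodContinuousLinearEquiv 1 ℂ A C).symm.toContinuousLinearMap.comp
    (ContinuousLinearMap.inl ℂ A C)

/-- The projection `A ⊕ C → A` as an operator. -/
def SemidirectSum.fstL : SemidirectSum A C →L[ℂ] A :=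
  (ContinuousLinearMap.fst ℂ A C).comp
    (WithLp.prodContinuousLinearEquiv 1 ℂ A C).toContinuousLinearMap

theorem SemidirectSum.inlL_apply (a : A) : inlL C a = inl C a := rfl

theorem SemidirectSum.fstL_apply (x : SemidirectSum A C) : fstL C x = x.fst := rfl

variable {C}

theorem isSplitIdeal_semidirectSum (hA : StronglyHUnital A) (hC : C ≤ multipliers A) :
    IsSplitIdeal (A := A) (B := SemidirectSum A C) (SemidirectSum.inlL C) (SemidirectSum.fstL C) where
  toIsBanachMul := isBanachMul_semidirectSum hA hC
  map_ι _ := rfl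
  ι_mul a b := by
    refine SemidirectSum.ext_parts C ?_ ?_
    · simp [SemidirectSum.fst_mul, SemidirectSum.inlL_apply, SemidirectSum.inl]
    · simp [SemidirectSum.snd_mul, SemidirectSum.inlL_apply, SemidirectSum.inl]
  mul_mem b a := ⟨(b * SemidirectSum.inlL C a).fst, SemidirectSum.ext_parts C rfl (by
    simp [SemidirectSum.snd_mul, SemidirectSum.inlL_apply, SemidirectSum.inl])⟩
  mem_mul a b := ⟨(SemidirectSum.inlL C a * b).fst, SemidirectSum.ext_parts C rfl (by
    simp [SemidirectSum.snd_mul, SemidirectSum.inlL_apply, SemidirectSum.inl])⟩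
  ker_mul x y hx hy := by
    rw [SemidirectSum.fstL_apply] at hx hy ⊢
    simp [SemidirectSum.fst_mul, hx, hy]

end Semidirect

end MatrixBanach

end

theorem mainTheorem2 {A : Type u} [NonUnitalNormedRing A] [NormedSpace ℂ A]
    [SMulCommClass ℂ A A] [IsScalarTower ℂ A A] [CompleteSpace A]
    (S R : 𝓜(ℂ, A)) (hS : IsMultiplier S) (hR : IsMultiplier R)
    (hRS : R * S = 1) (hSR : S * R ≠ 1)
    (hdense : Dense (corners S R)) (hbdd : SignedPermsActBoundedly S R)
    (hA : StronglyHUnital A)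
    (n : ℕ) (D : ContinuousMultilinearMap ℂ (fun _ : Fin (n + 1) => A) ℂ) (hD : IsCocycle D) :
    ∃ D' : ContinuousMultilinearMap ℂ
        (fun _ : Fin (n + 1) => SemidirectSum A (signedPermAlgebra S R)) ℂ,
      IsCocycle D' ∧ ∀ a : Fin (n + 1) → A, D' (fun i => SemidirectSum.inl _ (a i)) = D a :=
  exists_cocycle_extension hA
    (isSplitIdeal_semidirectSum hA (signedPermAlgebra_le_multipliers hS hR)) D hD
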